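/- Let $n\ge 1$, let $M=M_{n,n}(\mathbb{C})$ be the variety of $n\times n$ matrices, with $G=GL_n(\mathbb{C})$ acting by left multiplication, and for $1\le r\le n$ let $V_r\subseteq M$ be the closed subscheme defined by the vanishing of all $(n+1-r)\times(n+1-r)$ minors of the first $n+1-r$ columns. For an arc $\gamma\in J_\infty M=M_{n,n}(\mathbb{C}[[t]])$ write $\mathrm{ord}_\gamma(V_r)=e$ if the pullback along $\gamma$ of the ideal of $V_r$ is $(t^e)$. Let $\lambda=(\lambda_1\ge\dots\ge\lambda_n\ge 0)$ be a partition, put $\lambda_{n+1}=0$, $m_i=\lambda_i-\lambda_{i+1}$, and $$C=\mathrm{Cont}^{\lambda}(V_\bullet)=\{\gamma\in J_\infty M \mid \mathrm{ord}_\gamma(V_i)=\lambda_i \text{ for } 1\le i\le n\}.$$ Fix any integer $m>\lambda_1$, let $\psi_m:J_\infty M\to J_mM=M_{n,n}(\mathbb{C}[t]/(t^{m+1}))$ be truncation and $C_m=\psi_m(C)$. Let $L\subseteq M_{n,n}(\mathbb{C}[[t]])$ be the set of upper triangular matrices with $(j,j)$ entry $t^{m_{n+1-j}}$ and, for $i<j$,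 $(i,j)$ entry a polynomial $\sum_{0\le k<m_{n+1-j}}c_{ijk}t^k$; the coefficients $c_{ijk}$ identify $L$ with an affine space $\mathbb{A}^N$. Put $L_m=\psi_m(L)$. Then $C$ is an affine family of $J_mG$-orbits, with $L$ as space of normal forms. That is: 1. $C=\psi_m^{-1}(C_m)$, and $C_m\cap J_mV_1=\emptyset$. 2. $L\subseteq C$. The set $C_m$ is $J_mG$-invariant, and for every $x\in C_m$ there is exactly one $c\in\mathbb{C}^N$ such that the truncation of the corresponding element of $L$ lies in the orbit $J_mG\cdot x$. (So every $J_mG$-orbit in $C_m$ has a unique normal form in $L_m\cong L\cong\mathbb{A}^N$.) 3. $C_m$ is the set of $\mathbb{C}$-points of a reduced locally closed subscheme $S$ of the scheme $J_mM\cong\mathbb{A}^{n^2(m+1)}$. The action of the group scheme $J_mG$ restricts to $a:J_mG\times S\to S$, and the inclusion of $L_m$ is a morphism $s:\mathbb{A}^N\to S$. The map sending a point of $C_m$ to its normal form is given on $\mathbb{C}$-points by a morphism $p:S\to\mathbb{A}^N$. This $p$ is smooth and $J_mG$-equivariant for the trivial action on $\mathbb{A}^N$, it satisfies $p\circ s=\mathrm{id}$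 (in particular $p$ is surjective), and the orbit morphism $J_mG\times\mathbb{A}^N\to S$, $(g,u)\mapsto g\cdot s(u)$, is smooth and surjective. -/

import Mathlib

open CategoryTheory AlgebraicGeometry MonoidalCategory CartesianMonoidalCategory

namespace GLContact

noncomputable section

/-! ### Truncated power series, arcs and jets -/

/-- The truncated ring `R[[t]]/(t^(m+1)) = R[t]/(t^(m+1))`. -/
abbrev TruncRing (R : Type) [CommRing R] (m : ℕ) : Type :=
  PowerSeries R ⧸ Ideal.span {(PowerSeries.X : PowerSeries R) ^ (m + 1)}

theorem coeff_eq_of_sub_mem {R : Type} [CommRing R] {m : ℕ} (k : Fin (m + 1))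
    {f g : PowerSeries R}
    (h : f - g ∈ Ideal.span {(PowerSeries.X : PowerSeries R) ^ (m + 1)}) :
    PowerSeries.coeff k f = PowerSeries.coeff k g := by
  rw [Ideal.mem_span_singleton, PowerSeries.X_pow_dvd_iff] at h
  have := h k k.2
  rwa [map_sub, sub_eq_zero] at this

/-- The coefficient of `t^k`, for `k ≤ m`, of an element of `R[t]/(t^(m+1))`. -/
def jetCoeff {R : Type} [CommRing R] {m : ℕ} (k : Fin (m + 1)) (x : TruncRing R m) : R :=
  Quotient.liftOn' x (fun f => PowerSeries.coeff (k : ℕ) f) fun _ _ h =>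
    coeff_eq_of_sub_mem k ((Submodule.quotientRel_def _).1 h)

/-- The element `c 0 + c 1 * t + ... + c m * t^m` of `R[t]/(t^(m+1))`. -/
def jetOfCoeffs {R : Type} [CommRing R] {m : ℕ} (c : Fin (m + 1) → R) : TruncRing R m :=
  Ideal.Quotient.mk _ (∑ k : Fin (m + 1), PowerSeries.monomial (k : ℕ) (c k))

theorem jetCoeff_jetOfCoeffs {R : Type} [CommRing R] {m : ℕ} (c : Fin (m + 1) → R)
    (k : Fin (m + 1)) : jetCoeff k (jetOfCoeffs c) = c k := by
  change PowerSeries.coeff (k : ℕ) (∑ l : Fin (m + 1), PowerSeries.monomial (l : ℕ) (c l)) = c k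
  rw [map_sum, Finset.sum_eq_single k]
  · simp
  · intro b _ hb
    rw [PowerSeries.coeff_monomial, if_neg]
    exact fun h => hb (Fin.ext h.symm)
  · simp

theorem jetOfCoeffs_jetCoeff {R : Type} [CommRing R] {m : ℕ} (x : TruncRing R m) :
    jetOfCoeffs (fun k => jetCoeff k x) = x := by
  obtain ⟨f, rfl⟩ := Ideal.Quotient.mk_surjective x
  refine (Ideal.Quotient.eq (I := Ideal.span {(PowerSeries.X : PowerSeries R) ^ (m + 1)})).2 ?_
  rw [Ideal.mem_span_singleton, PowerSeries.X_pow_dvd_iff]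
  intro k hk
  have := jetCoeff_jetOfCoeffs (fun l : Fin (m + 1) => PowerSeries.coeff (l : ℕ) f) ⟨k, hk⟩
  rw [map_sub, sub_eq_zero]
  exact this

/-- Arcs of the space of `n × n` matrices (the `ℂ`-points of its arc space). -/
abbrev Arc (n : ℕ) : Type := Matrix (Fin n) (Fin n) (PowerSeries ℂ)

/-- `m`-jets of the space of `n × n` matrices (the `ℂ`-points of its `m`-th jet scheme). -/
abbrev Jet (n m : ℕ) : Type := Matrix (Fin n) (Fin n) (TruncRing ℂ m)

/-- The truncation map from matrices of power series to matrices over `R[t]/(t^(m+1))`. -/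
def psi {R : Type} [CommRing R] {n : ℕ} (m : ℕ) (A : Matrix (Fin n) (Fin n) (PowerSeries R)) :
    Matrix (Fin n) (Fin n) (TruncRing R m) :=
  A.map (Ideal.Quotient.mk _)

/-! ### Contact loci -/

/-- The arc `γ` of the affine space with coordinates `σ` has contact order exactly `e` with the
closed subscheme defined by `I`: the pullback of `I` along `γ` is the ideal `(t^e)`. -/
def HasContactOrder {σ : Type} (I : Ideal (MvPolynomial σ ℂ)) (γ : σ → PowerSeries ℂ)
    (e : ℕ) : Prop :=
  I.map (MvPolynomial.aeval γ) = Ideal.span {(PowerSeries.X : PowerSeries ℂ) ^ e}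

/-- The `ℂ`-points of the `m`-th jet scheme of the closed subscheme defined by `I`. -/
def jetsOf {σ : Type} (I : Ideal (MvPolynomial σ ℂ)) (m : ℕ) : Set (σ → TruncRing ℂ m) :=
  {x | ∀ f ∈ I, MvPolynomial.aeval x f = 0}

/-- The ideal of `V_(r+1)` (with `r : Fin n` counted from zero): it is generated by the maximal
minors of the first `n - r` columns of the generic matrix. -/
def detIdeal (n : ℕ) (r : Fin n) : Ideal (MvPolynomial (Fin n × Fin n) ℂ) :=
  Ideal.span (Set.range fun f : Fin (n - r) ↪o Fin n =>
    (Matrix.of fun a b : Fin (n - r) =>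
      (MvPolynomial.X (f a, Fin.castLE (Nat.sub_le n r) b) :
        MvPolynomial (Fin n × Fin n) ℂ)).det)

/-- The multi-contact locus of the determinantal chain; `lam i` is the part `λ_(i+1)`. -/
def contactLocus {n : ℕ} (lam : Fin n → ℕ) : Set (Arc n) :=
  {A | ∀ i, HasContactOrder (detIdeal n i) (fun q => A q.1 q.2) (lam i)}

/-- The image of the contact locus in the space of `m`-jets. -/
def contactJets {n : ℕ} (lam : Fin n → ℕ) (m : ℕ) : Set (Jet n m) :=
  psi m '' contactLocus lam

/-! ### Upper triangular normal forms -/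

/-- The difference `λ_i - λ_(i+1)` (where `λ_(n+1) = 0`), the index `i` being counted from zero. -/
def gap {n : ℕ} (lam : Fin n → ℕ) (i : Fin n) : ℕ :=
  lam i - if h : (i : ℕ) + 1 < n then lam ⟨i + 1, h⟩ else 0

/-- The exponent of the pivot in column `j` (from one): `λ_(n+1-j) - λ_(n+2-j)`. -/
def pivot {n : ℕ} (lam : Fin n → ℕ) (j : Fin n) : ℕ := gap lam j.rev

/-- The free coefficients of a normal form: those of `t^k` in the entry `(i,j)`, for `i < j` and
`k < pivot lam j`. -/
abbrev NFIndex {n : ℕ} (lam : Fin n → ℕ) : Type :=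
  Σ q : {q : Fin n × Fin n // q.1 < q.2}, Fin (pivot lam q.1.2)

/-- The normal form with given coefficients: the upper triangular matrix whose `j`-th diagonal
entry is `t^(pivot j)`, and whose entries above it are polynomials of degree `< pivot j`. -/
def normalForm {R : Type} [CommRing R] {n : ℕ} (lam : Fin n → ℕ) (c : NFIndex lam → R) :
    Matrix (Fin n) (Fin n) (PowerSeries R) :=
  Matrix.of fun i j =>
    if h : i < j then
      ∑ k : Fin (pivot lam j), PowerSeries.monomial (k : ℕ) (c ⟨⟨(i, j), h⟩, k⟩)
    else if i = j then PowerSeries.X ^ pivot lam j else 0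

/-! ### Schemes over the complex numbers -/

abbrev SpecC : Scheme.{0} := Spec (CommRingCat.of ℂ)

/-- `Spec ℂ` as a scheme over itself; `pt ⟶ S` are the `ℂ`-points of `S`. -/
abbrev pt : Over SpecC := Over.mk (𝟙 SpecC)

/-- The affine space over `ℂ` with coordinates indexed by `σ`. -/
def affineOver (σ : Type) : Over SpecC := Over.mk (𝔸(σ; SpecC) ↘ SpecC)

/-- The coordinate functions of `affineOver σ`. -/
def coordFun {σ : Type} (s : σ) : Γ((affineOver σ).left, ⊤) := AffineSpace.coord SpecC s

/-- A morphism to an affine space is a family of global functions. -/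
def affineHomEquiv (σ : Type) (T : Over SpecC) :
    (T ⟶ affineOver σ) ≃ (σ → Γ(T.left, ⊤)) where
  toFun f s := f.left.appTop (coordFun s)
  invFun v := Over.homMk (AffineSpace.homOfVector T.hom v) (AffineSpace.homOfVector_over _ _)
  left_inv f := by
    ext1
    refine AffineSpace.hom_ext ?_ fun s => ?_
    · exact (AffineSpace.homOfVector_over _ _).trans (Over.w f).symm
    · exact AffineSpace.homOfVector_appTop_coord _ _ s
  right_inv v := by
    funext s
    exact AffineSpace.homOfVector_appTop_coord _ _ s

/-- The `ℂ`-point of affine space with given coordinates. -/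
def affinePoint {σ : Type} (c : σ → ℂ) : pt ⟶ affineOver σ :=
  (affineHomEquiv σ pt).symm fun s => (Scheme.ΓSpecIso (CommRingCat.of ℂ)).inv (c s)

/-- The `m`-th jet scheme of the space of `n × n` matrices: the affine space whose coordinates
are the coefficients of `t^k`, `k ≤ m`, in the entries of a matrix. -/
def jetMat (n m : ℕ) : Over SpecC := affineOver (Fin n × Fin n × Fin (m + 1))

/-- The functor of points of the jet scheme: a `T`-point is a matrix over `Γ(T)[t]/(t^(m+1))`. -/
def jetMatEquiv (n m : ℕ) (T : Over SpecC) :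
    (T ⟶ jetMat n m) ≃ Matrix (Fin n) (Fin n) (TruncRing Γ(T.left, ⊤) m) :=
  (affineHomEquiv _ T).trans
    { toFun := fun v => Matrix.of fun i j => jetOfCoeffs fun k => v (i, j, k)
      invFun := fun A q => jetCoeff q.2.2 (A q.1 q.2.1)
      left_inv := fun v => by
        funext q
        exact jetCoeff_jetOfCoeffs _ _
      right_inv := fun A => by
        ext i j
        exact jetOfCoeffs_jetCoeff (A i j) }

/-- The `ℂ`-point of the jet scheme given by a jet. -/
def jetPoint {n m : ℕ} (x : Jet n m) : pt ⟶ jetMat n m :=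
  affinePoint fun q => jetCoeff q.2.2 (x q.1 q.2.1)

/-- The open subset of jets of matrices whose constant term has nonzero determinant. -/
def jetGLOpens (n m : ℕ) : (jetMat n m).left.Opens :=
  (jetMat n m).left.basicOpen
    (Matrix.of fun i j : Fin n =>
      (coordFun (i, j, 0) : Γ((affineOver (Fin n × Fin n × Fin (m + 1))).left, ⊤))).det

/-- The `m`-th jet scheme of `GL_n`, the open subscheme of invertible jets of matrices (the
preimage of `GL_n` under the projection from jets of matrices to matrices). -/
def jetGL (n m : ℕ) : Over SpecC := Over.mk ((jetGLOpens n m).ι ≫ (jetMat n m).hom)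

def jetGLIncl (n m : ℕ) : jetGL n m ⟶ jetMat n m := Over.homMk (jetGLOpens n m).ι rfl

/-- The action of `J_m GL_n` by left multiplication, on `T`-points. -/
def jetMul {n m : ℕ} {T : Over SpecC} (g : T ⟶ jetGL n m) (x : T ⟶ jetMat n m) :
    T ⟶ jetMat n m :=
  (jetMatEquiv n m T).symm
    (jetMatEquiv n m T (g ≫ jetGLIncl n m) * jetMatEquiv n m T x)

/-- The morphism from the affine space of coefficients that sends them to the `m`-jet of the
normal form with these coefficients. -/
def normalFormHom {n : ℕ} (lam : Fin n → ℕ) (m : ℕ) :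
    affineOver (NFIndex lam) ⟶ jetMat n m :=
  (jetMatEquiv n m _).symm (psi m (normalForm lam fun e => coordFun e))

/-- `ι : S ⟶ jetMat n m` exhibits `S` as the reduced locally closed subscheme of the jet scheme
whose `ℂ`-points are the elements of `Z`. -/
structure IsReducedLocus {n m : ℕ} (Z : Set (Jet n m)) {S : Over SpecC}
    (ι : S ⟶ jetMat n m) : Prop where
  isReduced : IsReduced S.left
  isImmersion : IsImmersion ι.left
  mem_iff : ∀ x, x ∈ Z ↔ ∃ y : pt ⟶ S, y ≫ ι = jetPoint x

/-- For an action `a` of a group scheme `G` on `S`: the morphism `p` to an affine space (on which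
`G` acts trivially) with section `s` makes `S` an affine family of `G`-orbits. -/
structure IsAffineFamilyOfOrbits {G S : Over SpecC} {σ : Type} (a : G ⊗ S ⟶ S)
    (p : S ⟶ affineOver σ) (s : affineOver σ ⟶ S) : Prop where
  smooth : Smooth p.left
  equivariant : a ≫ p = snd G S ≫ p
  isSection : s ≫ p = 𝟙 (affineOver σ)
  smooth_orbitMap : Smooth (G ◁ s ≫ a).left
  surjective_orbitMap : Surjective (G ◁ s ≫ a).left

end

end GLContact

/-! Left multiplication by an invertible matrix preserves the divisibility of all maximal minors of
the first `k` columns, so the contact locus is a union of orbits. Over `ℂ⟦X⟧`, elimination makes an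
arc upper triangular (`exists_upperTriangular`). The contact orders then fix the order `d_j` of each
diagonal entry (`exists_unit_diag`), and division with remainder yields a normal form
(`exists_mul_eq_normalForm`). The orders involved are less than `m`, so membership can be tested on
`m`-jets.

For the scheme structure, the jets in question are `G * L(c)` modulo `X ^ (m + 1)`, with `L(c)` a
normal form. Here `G` matters only modulo the rows of `X ^ (m + 1) * L(c)⁻¹`. It has a unique
representative `H` whose `j`-th column has degree at most `m - d_j`, and `H` has the same constant
term as `G` (`exists_representative`, `eq_zero_of_dvd_mul`). Hence `S` is taken to be `orbitSpace`,
an open subscheme of the affine space of pairs `(H, c)`. It is reduced, and `p` is a projection. The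
coefficients of `G` of high degree are free coordinates on the fibres of the orbit map, which is
therefore smooth.

The main point is that `S` maps to the jet scheme by an immersion (`isImmersion_orbitIncl`). Where
suitable minors of `H(0)` are invertible, `H` and `c` can be computed column by column from the jet
(`coeff_mem_of_coeff_mul_mem`). These minors are coefficients of minors of the jet
(`pullFun_minorFun`), so the locus comes from an open set of the jet scheme, and `(H, c)` extends to
a map on it. The immersion is a monomorphism, which gives uniqueness of normal forms. -/

namespace GLContact

/-! ### Division with remainder by a triangular matrix of power series -/

section Reduction

open PowerSeries

variable {R : Type} [CommRing R] {n : ℕ}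

theorem X_pow_mul_cancel {k : ℕ} {f g : R⟦X⟧} (h : f * X ^ k = g * X ^ k) : f = g := by
  ext i
  have := congrArg (coeff (i + k)) h
  simpa [coeff_mul_X_pow] using this

theorem eq_zero_of_mul_X_pow {k : ℕ} {f : R⟦X⟧} (h : f * X ^ k = 0) : f = 0 :=
  X_pow_mul_cancel (k := k) (by rw [h, zero_mul])

theorem exists_mul_X_pow_add (a : ℕ) (f : R⟦X⟧) :
    ∃ q : R⟦X⟧, ∀ k, a ≤ k → coeff k (f - q * X ^ a) = 0 := by
  refine ⟨mk fun k => coeff (k + a) f, fun k hk => ?_⟩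
  obtain ⟨l, rfl⟩ := Nat.exists_eq_add_of_le' hk
  rw [map_sub, coeff_mul_X_pow, coeff_mk, sub_self]

/-- The quotient of `f` by `X ^ a`, forgetting the coefficients of low degree. -/
noncomputable def divXPow (a : ℕ) (f : R⟦X⟧) : R⟦X⟧ := (exists_mul_X_pow_add a f).choose

theorem coeff_sub_divXPow (a : ℕ) (f : R⟦X⟧) (k : ℕ) (hk : a ≤ k) :
    coeff k (f - divXPow a f * X ^ a) = 0 :=
  (exists_mul_X_pow_add a f).choose_spec k hk

/-- The quotients in the reduction of the row `v` by the upper triangular matrix `P` with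
diagonal entries `X ^ a j`. -/
noncomputable def rowQuotient (a : Fin n → ℕ) (P : Matrix (Fin n) (Fin n) R⟦X⟧)
    (v : Fin n → R⟦X⟧) (j : Fin n) : R⟦X⟧ :=
  divXPow (a j) (v j - ∑ i : {i : Fin n // i < j}, rowQuotient a P v i * P i j)
termination_by j.val
decreasing_by exact i.2

theorem sum_eq_sum_lt_add {M : Type*} [AddCommMonoid M] (j : Fin n) (f : Fin n → M)
    (h : ∀ i, j < i → f i = 0) : ∑ i, f i = ∑ i : {i : Fin n // i < j}, f i + f j := by
  rw [← Finset.sum_subtype (Finset.univ.filter (· < j)) (by simp) f]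
  rw [add_comm, ← Finset.sum_insert (by simp)]
  refine (Finset.sum_subset (Finset.subset_univ _) fun i _ hi => h i ?_).symm
  simp only [Finset.mem_insert, Finset.mem_filter, Finset.mem_univ, true_and, not_or] at hi
  omega

/-- Triangularity lets the quotients be found from left to right: the `j`-th one divides what
remains of `v j` after the earlier rows of `P` are subtracted. The pivots are powers of `X`, so any
coefficient ring will do. -/
theorem exists_row_reduction {a : Fin n → ℕ} {P : Matrix (Fin n) (Fin n) R⟦X⟧}
    (hP : ∀ i j, j < i → P i j = 0) (hPd : ∀ j, P j j = X ^ a j) (v : Fin n → R⟦X⟧) :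
    ∃ e : Fin n → R⟦X⟧, ∀ j k, a j ≤ k → coeff k (v j - ∑ i, e i * P i j) = 0 := by
  refine ⟨rowQuotient a P v, fun j k hk => ?_⟩
  rw [sum_eq_sum_lt_add j _ fun i hi => by rw [hP i j hi, mul_zero], hPd,
    ← sub_sub]
  conv_lhs => rw [rowQuotient]
  exact coeff_sub_divXPow _ _ _ hk

theorem exists_reduction {a : Fin n → ℕ} {P : Matrix (Fin n) (Fin n) R⟦X⟧}
    (hP : ∀ i j, j < i → P i j = 0) (hPd : ∀ j, P j j = X ^ a j)
    (V : Matrix (Fin n) (Fin n) R⟦X⟧) :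
    ∃ E : Matrix (Fin n) (Fin n) R⟦X⟧,
      ∀ i j k, a j ≤ k → coeff k ((V - E * P) i j) = 0 := by
  choose E hE using fun i => exists_row_reduction hP hPd (V i)
  exact ⟨Matrix.of E, fun i j k hk => hE i j k hk⟩

/-- This makes the multiplier strictly upper triangular when only the entries above the diagonal are
reduced. -/
theorem quotient_eq_zero {a : Fin n → ℕ} {P : Matrix (Fin n) (Fin n) R⟦X⟧}
    (hP : ∀ i j, j < i → P i j = 0) (hPd : ∀ j, P j j = X ^ a j) {v e : Fin n → R⟦X⟧}
    (he : ∀ j k, a j ≤ k → coeff k (v j - ∑ i, e i * P i j) = 0) {p : Fin n}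
    (hv : ∀ j ≤ p, v j = 0) (j : Fin n) (hj : j ≤ p) : e j = 0 := by
  induction j using WellFoundedLT.induction with
  | ind j ih =>
    ext k
    have := he j (k + a j) le_add_self
    rw [sum_eq_sum_lt_add j _ fun i hi => by rw [hP i j hi, mul_zero], hPd, hv j hj,
      Finset.sum_eq_zero fun i _ => by rw [ih i i.2 (i.2.le.trans hj), zero_mul]] at this
    simpa [coeff_mul_X_pow] using this

theorem upperTriangular_of_mul {d : Fin n → ℕ} {L Q : Matrix (Fin n) (Fin n) R⟦X⟧}
    (hL : ∀ i j, j < i → L i j = 0) (hLd : ∀ j, L j j = X ^ d j)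
    (h : ∀ i j, j < i → (Q * L) i j = 0) (i j : Fin n) (hj : j < i) : Q i j = 0 := by
  induction j using WellFoundedLT.induction with
  | ind j ih =>
    have := h i j hj
    rw [Matrix.mul_apply, sum_eq_sum_lt_add j _ fun l hl => by rw [hL l j hl, mul_zero], hLd,
      Finset.sum_eq_zero fun l _ => by rw [ih l l.2 (l.2.trans hj), zero_mul], zero_add] at this
    exact eq_zero_of_mul_X_pow this

theorem det_eq_X_pow {d : Fin n → ℕ} {L : Matrix (Fin n) (Fin n) R⟦X⟧}
    (hL : ∀ i j, j < i → L i j = 0) (hLd : ∀ j, L j j = X ^ d j) :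
    L.det = X ^ ∑ j, d j := by
  rw [Matrix.det_of_isUpperTriangular (fun i j hij => hL i j hij), Finset.prod_congr rfl
    fun j _ => hLd j, Finset.prod_pow_eq_pow_sum]

/-- `P` is `X ^ N` times the inverse of `L`, obtained from the adjugate. The strict inequality
leaves a spare factor `X`, so reduction modulo the rows of `P` keeps constant terms, and with them
invertibility. -/
theorem exists_mul_eq_X_pow {d : Fin n → ℕ} {L : Matrix (Fin n) (Fin n) R⟦X⟧}
    (hL : ∀ i j, j < i → L i j = 0) (hLd : ∀ j, L j j = X ^ d j) {N : ℕ}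
    (hN : ∑ j, d j < N) :
    ∃ P : Matrix (Fin n) (Fin n) R⟦X⟧, P * L = (X ^ N : R⟦X⟧) • 1 ∧
      (∀ i j, j < i → P i j = 0) ∧ (∀ j, P j j = X ^ (N - d j)) ∧
      ∀ i j, constantCoeff (P i j) = 0 := by
  obtain ⟨r, rfl⟩ := Nat.exists_eq_add_of_lt hN
  let P : Matrix (Fin n) (Fin n) R⟦X⟧ := (X ^ (r + 1) : R⟦X⟧) • L.adjugate
  have hPL : P * L = (X ^ ((∑ j, d j) + r + 1) : R⟦X⟧) • 1 := by
    rw [Matrix.smul_mul, Matrix.adjugate_mul, smul_smul, det_eq_X_pow hL hLd, ← pow_add]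
    congr 2
    ring
  have htri : ∀ i j, j < i → P i j = 0 := upperTriangular_of_mul hL hLd fun i j hij => by
    rw [hPL, Matrix.smul_apply, Matrix.one_apply_ne hij.ne', smul_zero]
  refine ⟨P, hPL, htri, fun j => ?_, fun i j => ?_⟩
  · have h1 := congrFun (congrFun hPL j) j
    rw [Matrix.mul_apply, Finset.sum_eq_single j, hLd, Matrix.smul_apply, Matrix.one_apply_eq,
      smul_eq_mul, mul_one] at h1
    · have hd : d j ≤ ∑ j, d j := Finset.single_le_sum (fun _ _ => Nat.zero_le _)
        (Finset.mem_univ j)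
      refine X_pow_mul_cancel (k := d j) ?_
      rw [h1, ← pow_add]
      congr 1
      omega
    · intro l _ hl
      rcases lt_or_gt_of_ne hl with hl | hl
      · rw [htri j l hl, zero_mul]
      · rw [hL l j hl, mul_zero]
    · simp
  · change constantCoeff (X ^ (r + 1) * L.adjugate i j) = 0
    simp

/-- Modulo `X ^ N`, a matrix times `L` only depends on a canonical representative of the matrix,
whose `j`-th column has degree less than `N - d j`. -/
theorem exists_representative {d : Fin n → ℕ} {L : Matrix (Fin n) (Fin n) R⟦X⟧}
    (hL : ∀ i j, j < i → L i j = 0) (hLd : ∀ j, L j j = X ^ d j) {N : ℕ}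
    (hN : ∑ j, d j < N) (V : Matrix (Fin n) (Fin n) R⟦X⟧) :
    ∃ W : Matrix (Fin n) (Fin n) R⟦X⟧, (∀ i j k, N - d j ≤ k → coeff k (W i j) = 0) ∧
      (∀ i j, X ^ N ∣ (V * L) i j - (W * L) i j) ∧
      ∀ i j, constantCoeff (W i j) = constantCoeff (V i j) := by
  obtain ⟨P, hPL, htri, hdiag, hconst⟩ := exists_mul_eq_X_pow hL hLd hN
  obtain ⟨E, hE⟩ := exists_reduction htri hdiag V
  refine ⟨V - E * P, hE, fun i j => ?_, fun i j => ?_⟩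
  -- The difference of the two products is `E * P * L = X ^ N • E`.
  · rw [← Matrix.sub_apply, ← Matrix.sub_mul, sub_sub_cancel, Matrix.mul_assoc, hPL,
      Matrix.mul_smul, Matrix.mul_one]
    exact Dvd.intro _ rfl
  · simp [Matrix.mul_apply, hconst]

/-- Once the earlier columns of `W` vanish, the `j`-th column of `W * L` is that of `W` times `X ^ d
j`. Its degree is too small for divisibility by `X ^ N`. -/
theorem eq_zero_of_dvd_mul {d : Fin n → ℕ} {L : Matrix (Fin n) (Fin n) R⟦X⟧}
    (hL : ∀ i j, j < i → L i j = 0) (hLd : ∀ j, L j j = X ^ d j) {N : ℕ}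
    {W : Matrix (Fin n) (Fin n) R⟦X⟧} (hW : ∀ i j k, N - d j ≤ k → coeff k (W i j) = 0)
    (h : ∀ i j, X ^ N ∣ (W * L) i j) : W = 0 := by
  ext1 i j
  induction j using WellFoundedLT.induction with
  | ind j ih =>
    have := h i j
    rw [Matrix.mul_apply, sum_eq_sum_lt_add j _ fun l hl => by rw [hL l j hl, mul_zero], hLd,
      Finset.sum_eq_zero fun l _ => by rw [ih l l.2, Matrix.zero_apply, zero_mul], zero_add,
      X_pow_dvd_iff] at this
    ext k
    by_cases hk : N - d j ≤ k
    · simpa using hW i j k hk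
    · simpa [coeff_mul_X_pow] using this (k + d j) (by omega)

end Reduction

/-! ### Recovering both factors from the coefficients of their product -/

section Subring

open PowerSeries

variable {B : Type} [CommRing B] {n : ℕ}

/-- The matrix lifts to power series over `A`, where its determinant is already a unit. -/
theorem exists_leftInverse_coeff_mem (A : Subring B) {ι : Type} [Fintype ι] [DecidableEq ι]
    {M : Matrix ι ι B⟦X⟧} (hM : ∀ i j k, coeff k (M i j) ∈ A)
    (hu : ∃ a ∈ A, a * constantCoeff M.det = 1) :
    ∃ N : Matrix ι ι B⟦X⟧, (∀ i j k, coeff k (N i j) ∈ A) ∧ N * M = 1 := by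
  let M' : Matrix ι ι A⟦X⟧ := Matrix.of fun i j => mk fun k => ⟨_, hM i j k⟩
  have hMM : M'.map (PowerSeries.map A.subtype) = M := by
    ext i j k
    simp [M']
  obtain ⟨a, ha, hau⟩ := hu
  have hdet : IsUnit M'.det := by
    rw [isUnit_iff_constantCoeff, isUnit_iff_exists_inv']
    refine ⟨⟨a, ha⟩, Subtype.ext ?_⟩
    rw [← hMM, ← RingHom.mapMatrix_apply, ← RingHom.map_det] at hau
    rw [← coeff_zero_eq_constantCoeff_apply, coeff_map] at hau
    simpa using hau
  refine ⟨M'⁻¹.map (PowerSeries.map A.subtype), fun i j k => by simp, ?_⟩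
  have := congrArg (fun m => Matrix.map m (PowerSeries.map A.subtype))
    (Matrix.nonsing_inv_mul M' hdet)
  simpa [Matrix.map_mul, hMM] using this

theorem coeff_mul_mem (A : Subring B) {p q : B⟦X⟧} {k : ℕ} (hp : ∀ i, coeff i p ∈ A)
    (hq : ∀ i ≤ k, coeff i q ∈ A) : coeff k (p * q) ∈ A := by
  rw [coeff_mul]
  exact sum_mem fun x hx => mul_mem (hp _)
    (hq _ (Finset.HasAntidiagonal.mem_antidiagonal.1 hx ▸ Nat.le_add_left _ _))

/-- Induction on columns. The earlier columns of `H`, restricted to the rows `φ j`, form an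
invertible matrix. This yields column `j` of `L`, and then column `j` of `H`. Taking for `A` the
image of a ring map later turns membership into the extension of functions. -/
theorem coeff_mem_of_coeff_mul_mem (A : Subring B) {d : Fin n → ℕ} {m : ℕ}
    (hd : ∀ j, d j ≤ m) {H L : Matrix (Fin n) (Fin n) B⟦X⟧}
    (hL : ∀ i j, j < i → L i j = 0) (hLd : ∀ j, L j j = X ^ d j)
    (hLr : ∀ i j, i < j → ∀ k, d j ≤ k → coeff k (L i j) = 0)
    (hH : ∀ i j k, m + 1 - d j ≤ k → coeff k (H i j) = 0)
    (hHL : ∀ i j k, k ≤ m → coeff k ((H * L) i j) ∈ A)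
    (φ : ∀ j : Fin n, {i // i < j} → Fin n)
    (hφ : ∀ j, ∃ a ∈ A, a * constantCoeff (H.submatrix (φ j) Subtype.val).det = 1)
    (j i : Fin n) (k : ℕ) : coeff k (H i j) ∈ A ∧ coeff k (L i j) ∈ A := by
  induction j using WellFoundedLT.induction generalizing i k with
  | ind j ih =>
    have hcol : ∀ r, (H * L) r j = ∑ l : {l // l < j}, H r l * L l j + H r j * X ^ d j := by
      intro r
      rw [Matrix.mul_apply, sum_eq_sum_lt_add j _ fun l hl => by rw [hL l j hl, mul_zero], hLd]
    obtain ⟨N, hN, hNM⟩ := exists_leftInverse_coeff_mem A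
      (M := H.submatrix (φ j) Subtype.val) (fun a b k => (ih b b.2 _ k).1) (hφ j)
    -- Inverting the block solves for column `j` of `L` up to a multiple of `X ^ d j`, which does
    -- not affect the coefficients below `d j`; the others are known.
    have hLj : ∀ l : {l // l < j}, L l j =
        ∑ r, N l r * (H * L) (φ j r) j - (∑ r, N l r * H (φ j r) j) * X ^ d j := by
      intro l
      have h1 : ∀ l, ∑ r, N l r * (∑ x : {l // l < j}, H (φ j r) x * L x j) = L l j := by
        intro l
        have := congrArg (fun M => M.mulVec (fun x : {l // l < j} => L x j) l) hNM
        rw [Matrix.one_mulVec, ← Matrix.mulVec_mulVec] at this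
        exact this
      rw [← h1 l, Finset.sum_mul, ← Finset.sum_sub_distrib]
      refine Finset.sum_congr rfl fun r _ => ?_
      rw [hcol]
      ring
    have hLA : ∀ i k, coeff k (L i j) ∈ A := by
      intro i k
      rcases lt_trichotomy i j with hij | rfl | hij
      · by_cases hk : d j ≤ k
        · rw [hLr i j hij k hk]
          exact zero_mem A
        · rw [hLj ⟨i, hij⟩, map_sub, coeff_mul_X_pow', if_neg hk, sub_zero, map_sum]
          refine sum_mem fun r _ => coeff_mul_mem A (hN _ _) fun i hi => hHL _ _ _ ?_
          have := hd j
          omega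
      · rw [hLd, coeff_X_pow]
        split_ifs
        · exact one_mem A
        · exact zero_mem A
      · rw [hL i j hij, map_zero]
        exact zero_mem A
    refine ⟨?_, hLA i k⟩
    by_cases hk : m + 1 - d j ≤ k
    · rw [hH i j k hk]
      exact zero_mem A
    -- The degree bound on `H` leaves only `k + d j ≤ m`, exactly the range where the product is
    -- known.
    · have : coeff k (H i j) = coeff (k + d j) ((H * L) i j) -
          coeff (k + d j) (∑ l : {l // l < j}, H i l * L l j) := by
        rw [hcol, map_add, coeff_mul_X_pow, add_sub_cancel_left]
      rw [this, map_sum]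
      exact sub_mem (hHL _ _ _ (by omega)) (sum_mem fun l _ =>
        coeff_mul_mem A (fun k => (ih l l.2 i k).1) fun k _ => hLA l k)

end Subring

/-! ### Divisibility of the maximal minors of the first columns -/

section Minors

variable {R : Type} [CommRing R]

/-- A weak form of the Cauchy-Binet formula. -/
theorem det_mul_mem {ι κ : Type} [Fintype ι] [DecidableEq ι] [Fintype κ]
    (M : Matrix ι κ R) (N : Matrix κ ι R) (I : Ideal R)
    (h : ∀ φ : ι → κ, (N.submatrix φ id).det ∈ I) : (M * N).det ∈ I := by
  classical
  have : (M * N).det = ∑ φ : ι → κ, (∏ a, M a (φ a)) * (N.submatrix φ id).det := by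
    have hrow : M * N = Matrix.of fun a => ∑ r : κ, M a r • N r := by
      ext a b
      simp [Matrix.mul_apply]
    rw [hrow]
    change Matrix.detRowAlternating.toMultilinearMap (fun a => ∑ r : κ, M a r • N r) = _
    rw [MultilinearMap.map_sum]
    exact Finset.sum_congr rfl fun φ _ => MultilinearMap.map_smul_univ _ _ _
  rw [this]
  exact Ideal.sum_mem _ fun φ _ => Ideal.mul_mem_left _ _ (h φ)

/-- All the maximal minors of the first `k` columns are divisible by `p`. -/
def MinorsDvd {n : ℕ} (A : Matrix (Fin n) (Fin n) R) (k : ℕ) (hk : k ≤ n) (p : R) : Prop :=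
  ∀ φ : Fin k → Fin n, p ∣ (A.submatrix φ (Fin.castLE hk)).det

variable {n k : ℕ} {hk : k ≤ n} {p : R} {A : Matrix (Fin n) (Fin n) R}

theorem MinorsDvd.mul (h : MinorsDvd A k hk p) (g : Matrix (Fin n) (Fin n) R) :
    MinorsDvd (g * A) k hk p := fun φ => by
  have : (g * A).submatrix φ (Fin.castLE hk) =
      g.submatrix φ id * A.submatrix id (Fin.castLE hk) := by
    rw [← Matrix.submatrix_mul_equiv _ _ _ (Equiv.refl _) _]
    rfl
  rw [this, ← Ideal.mem_span_singleton]
  refine det_mul_mem _ _ _ fun ψ => ?_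
  rw [Ideal.mem_span_singleton]
  exact h ψ

theorem minorsDvd_mul_iff {g : Matrix (Fin n) (Fin n) R} (hg : IsUnit g.det) :
    MinorsDvd (g * A) k hk p ↔ MinorsDvd A k hk p := by
  refine ⟨fun h => ?_, fun h => h.mul g⟩
  have := h.mul g⁻¹
  rwa [← Matrix.mul_assoc, Matrix.nonsing_inv_mul _ hg, Matrix.one_mul] at this

/-- In the first `k` columns every row is zero or one of the top `k` rows, so each minor is a
multiple of the leading one. -/
theorem minorsDvd_iff_of_upperTriangular (hA : ∀ i j, j < i → A i j = 0) :
    MinorsDvd A k hk p ↔ p ∣ ∏ a : Fin k, A (Fin.castLE hk a) (Fin.castLE hk a) := by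
  have hdet : (A.submatrix (Fin.castLE hk) (Fin.castLE hk)).det =
      ∏ a : Fin k, A (Fin.castLE hk a) (Fin.castLE hk a) :=
    Matrix.det_of_isUpperTriangular fun i j hij => hA _ _ hij
  refine ⟨fun h => hdet ▸ h _, fun h φ => ?_⟩
  have : A.submatrix φ (Fin.castLE hk) =
      (Matrix.of fun a b : Fin k => if φ a = Fin.castLE hk b then (1 : R) else 0) *
        A.submatrix (Fin.castLE hk) (Fin.castLE hk) := by
    ext a b
    simp only [Matrix.mul_apply, Matrix.of_apply, Matrix.submatrix_apply, ite_mul, one_mul,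
      zero_mul]
    by_cases hφ : (φ a : ℕ) < k
    · rw [Finset.sum_eq_single ⟨φ a, hφ⟩]
      · exact (if_pos (Fin.ext rfl)).symm
      · exact fun c _ hc => if_neg fun h : φ a = Fin.castLE hk c =>
          hc (Fin.ext (congrArg Fin.val h).symm)
      · simp
    · rw [hA _ _ (Fin.lt_def.2 (b.2.trans_le (not_lt.1 hφ))), Finset.sum_eq_zero]
      exact fun c _ => if_neg fun h => hφ (by rw [h]; exact c.2)
  rw [this, Matrix.det_mul, hdet]
  exact Dvd.dvd.mul_left h _

/-- The ideal uses increasing row choices, while invariance is easier with arbitrary ones. A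
repeated row gives determinant zero, and reordering only changes the sign. -/
theorem minorsDvd_iff_orderEmb :
    MinorsDvd A k hk p ↔ ∀ f : Fin k ↪o Fin n, p ∣ (A.submatrix f (Fin.castLE hk)).det := by
  refine ⟨fun h f => h f, fun h φ => ?_⟩
  by_cases hφ : Function.Injective φ
  · have hcard : (Finset.univ.image φ).card = k := by
      rw [Finset.card_image_of_injective _ hφ, Finset.card_univ, Fintype.card_fin]
    let f := (Finset.univ.image φ).orderEmbOfFin hcard
    have hf : ∀ a, ∃ b, f b = φ a := fun a => by
      have : φ a ∈ Set.range f := by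
        rw [Finset.range_orderEmbOfFin]
        simp
      exact this
    choose σ hσ using hf
    have hσi : Function.Injective σ := fun a b hab => hφ (by rw [← hσ, ← hσ, hab])
    let τ := Equiv.ofBijective σ (Finite.injective_iff_bijective.1 hσi)
    have : A.submatrix φ (Fin.castLE hk) = (A.submatrix f (Fin.castLE hk)).submatrix τ id := by
      ext a b
      simp [τ, hσ]
    rw [this, Matrix.det_permute]
    exact Dvd.dvd.mul_left (h f) _
  · obtain ⟨a, b, hab, hne⟩ := Function.not_injective_iff.1 hφ
    rw [Matrix.det_zero_of_row_eq hne (by ext c; simp [hab])]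
    exact dvd_zero _

end Minors

/-! ### Contact orders, truncation and invariance -/

section Contact

open PowerSeries

theorem exists_unit_mul_X_pow {K : Type} [Field K] {f : K⟦X⟧} {e : ℕ} (h1 : X ^ e ∣ f)
    (h2 : ¬ X ^ (e + 1) ∣ f) :
    ∃ u : K⟦X⟧ˣ, f = (u : K⟦X⟧) * X ^ e := by
  obtain ⟨u, rfl⟩ := h1
  have hu : IsUnit u := by
    rw [isUnit_iff_constantCoeff, isUnit_iff_ne_zero]
    intro h0
    rw [← X_dvd_iff] at h0
    exact h2 (by rw [pow_succ]; exact mul_dvd_mul_left _ h0)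
  exact ⟨hu.unit, mul_comm _ _⟩

theorem span_eq_span_X_pow_iff {K : Type} [Field K] {s : Set K⟦X⟧} {e : ℕ} :
    Ideal.span s = Ideal.span {(X : K⟦X⟧) ^ e} ↔
      (∀ f ∈ s, X ^ e ∣ f) ∧ ¬ ∀ f ∈ s, X ^ (e + 1) ∣ f := by
  constructor
  · intro h
    refine ⟨fun f hf => ?_, fun h' => ?_⟩
    · rw [← Ideal.mem_span_singleton, ← h]
      exact Ideal.subset_span hf
    · have hle : Ideal.span {(X : K⟦X⟧) ^ e} ≤ Ideal.span {X ^ (e + 1)} := by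
        rw [← h, Ideal.span_le]
        exact fun f hf => Ideal.mem_span_singleton.2 (h' f hf)
      rw [Ideal.span_singleton_le_span_singleton, X_pow_dvd_iff] at hle
      simpa using hle e (Nat.lt_succ_self e)
  · rintro ⟨h1, h2⟩
    refine le_antisymm (Ideal.span_le.2 fun f hf => Ideal.mem_span_singleton.2 (h1 f hf)) ?_
    rw [Ideal.span_singleton_le_iff_mem]
    push Not at h2
    obtain ⟨f, hf, hX⟩ := h2
    obtain ⟨u, rfl⟩ := exists_unit_mul_X_pow (h1 f hf) hX
    rw [← Units.inv_mul_cancel_left u (X ^ e)]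
    exact Ideal.mul_mem_left _ _ (Ideal.subset_span hf)

theorem map_detIdeal {n : ℕ} (r : Fin n) {S : Type} [CommRing S] [Algebra ℂ S]
    (A : Matrix (Fin n) (Fin n) S) :
    (detIdeal n r).map (MvPolynomial.aeval fun q : Fin n × Fin n => A q.1 q.2) =
      Ideal.span (Set.range fun f : Fin (n - r) ↪o Fin n =>
        (A.submatrix f (Fin.castLE (Nat.sub_le n r))).det) := by
  rw [detIdeal, Ideal.map_span, ← Set.range_comp]
  congr 2
  ext1 f
  change (MvPolynomial.aeval fun q : Fin n × Fin n => A q.1 q.2) (Matrix.det _) = _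
  rw [AlgHom.map_det]
  congr 1
  ext a b
  simp

theorem hasContactOrder_detIdeal_iff {n : ℕ} {r : Fin n} {A : Arc n} {e : ℕ} :
    HasContactOrder (detIdeal n r) (fun q => A q.1 q.2) e ↔
      MinorsDvd A (n - r) (Nat.sub_le n r) (X ^ e) ∧
        ¬ MinorsDvd A (n - r) (Nat.sub_le n r) (X ^ (e + 1)) := by
  rw [HasContactOrder, map_detIdeal, span_eq_span_X_pow_iff, minorsDvd_iff_orderEmb,
    minorsDvd_iff_orderEmb]
  simp only [Set.forall_mem_range]

theorem mem_contactLocus_iff {n : ℕ} {lam : Fin n → ℕ} {A : Arc n} :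
    A ∈ contactLocus lam ↔ ∀ r : Fin n,
      MinorsDvd A (n - r) (Nat.sub_le n r) (X ^ lam r) ∧
        ¬ MinorsDvd A (n - r) (Nat.sub_le n r) (X ^ (lam r + 1)) :=
  forall_congr' fun _ => hasContactOrder_detIdeal_iff

theorem mul_mem_contactLocus_iff {n : ℕ} {lam : Fin n → ℕ} {A g : Arc n} (hg : IsUnit g.det) :
    g * A ∈ contactLocus lam ↔ A ∈ contactLocus lam := by
  simp only [mem_contactLocus_iff, minorsDvd_mul_iff hg]

theorem psi_eq_psi_iff {R : Type} [CommRing R] {n m : ℕ}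
    {A B : Matrix (Fin n) (Fin n) R⟦X⟧} :
    psi m A = psi m B ↔ ∀ i j, X ^ (m + 1) ∣ A i j - B i j := by
  rw [← Matrix.ext_iff]
  refine forall₂_congr fun i j => ?_
  rw [← Ideal.mem_span_singleton]
  exact Ideal.Quotient.eq

theorem psi_mul {R : Type} [CommRing R] {n m : ℕ}
    (A B : Matrix (Fin n) (Fin n) R⟦X⟧) : psi m (A * B) = psi m A * psi m B :=
  Matrix.map_mul

theorem psi_add {R : Type} [CommRing R] {n m : ℕ}
    (A B : Matrix (Fin n) (Fin n) R⟦X⟧) : psi m (A + B) = psi m A + psi m B :=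
  Matrix.map_add _ (map_add _) _ _

theorem psi_surjective {R : Type} [CommRing R] {n m : ℕ}
    (x : Matrix (Fin n) (Fin n) (TruncRing R m)) : ∃ A, psi m A = x := by
  choose A hA using fun i j => Ideal.Quotient.mk_surjective (x i j)
  exact ⟨Matrix.of A, by ext i j; exact hA i j⟩

theorem det_submatrix_sub_dvd {R : Type} [CommRing R] {n m : ℕ}
    {A B : Matrix (Fin n) (Fin n) R⟦X⟧} (h : psi m A = psi m B)
    {ι : Type} [Fintype ι] [DecidableEq ι] (φ ψ : ι → Fin n) :
    X ^ (m + 1) ∣ (A.submatrix φ ψ).det - (B.submatrix φ ψ).det := by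
  rw [← Ideal.mem_span_singleton, ← Ideal.Quotient.eq, RingHom.map_det, RingHom.map_det]
  exact congrArg (fun M => (Matrix.submatrix M φ ψ).det) h

theorem minorsDvd_congr {R : Type} [CommRing R] {n m : ℕ}
    {A B : Matrix (Fin n) (Fin n) R⟦X⟧} (h : psi m A = psi m B) {k : ℕ} {hk : k ≤ n} {e : ℕ}
    (he : e ≤ m + 1) : MinorsDvd A k hk (X ^ e) ↔ MinorsDvd B k hk (X ^ e) :=
  forall_congr' fun φ => by
    rw [← dvd_iff_dvd_of_dvd_sub ((pow_dvd_pow X he).trans (det_submatrix_sub_dvd h φ _))]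

/-- Exact order `lam r` is tested with powers up to `X ^ (lam r + 1)`, all visible modulo `X ^ (m +
1)`. -/
theorem contactLocus_congr {n m : ℕ} {lam : Fin n → ℕ} (hm : ∀ i, lam i < m) {A B : Arc n}
    (h : psi m A = psi m B) : A ∈ contactLocus lam ↔ B ∈ contactLocus lam := by
  simp only [mem_contactLocus_iff]
  refine forall_congr' fun r => ?_
  rw [minorsDvd_congr h (by have := hm r; omega), minorsDvd_congr h (by have := hm r; omega)]

theorem contactLocus_eq_preimage {n m : ℕ} {lam : Fin n → ℕ} (hm : ∀ i, lam i < m) :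
    contactLocus lam = psi m ⁻¹' contactJets lam m := by
  refine Set.Subset.antisymm (Set.subset_preimage_image _ _) ?_
  rintro A ⟨B, hB, h⟩
  exact (contactLocus_congr hm h).1 hB

theorem notMem_jetsOf_detIdeal {n m : ℕ} {lam : Fin n → ℕ} (hm : ∀ i, lam i < m) {x : Jet n m}
    (hx : x ∈ contactJets lam m) (r : Fin n) :
    (fun q : Fin n × Fin n => x q.1 q.2) ∉ jetsOf (detIdeal n r) m := by
  obtain ⟨A, hA, rfl⟩ := hx
  intro h
  -- Vanishing of the minors on the jet would make them divisible by `X ^ (m + 1)`, hence by the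
  -- forbidden `X ^ (lam r + 1)`.
  refine (mem_contactLocus_iff.1 hA r).2 (minorsDvd_iff_orderEmb.2 fun f => ?_)
  have h1 : ((psi m A).submatrix f (Fin.castLE (Nat.sub_le n r))).det ∈
      (detIdeal n r).map (MvPolynomial.aeval fun q : Fin n × Fin n => psi m A q.1 q.2) := by
    rw [map_detIdeal]
    exact Ideal.subset_span ⟨f, rfl⟩
  have h2 : (detIdeal n r).map
      (MvPolynomial.aeval fun q : Fin n × Fin n => psi m A q.1 q.2) ≤ ⊥ := by
    rw [Ideal.map_le_iff_le_comap]
    exact fun p hp => Ideal.mem_bot.2 (h p hp)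
  have h3 := Ideal.mem_bot.1 (h2 h1)
  have h4 : (psi m A).submatrix f (Fin.castLE (Nat.sub_le n r)) =
      (A.submatrix f (Fin.castLE (Nat.sub_le n r))).map (Ideal.Quotient.mk _) := rfl
  rw [h4, ← RingHom.mapMatrix_apply, ← RingHom.map_det, Ideal.Quotient.eq_zero_iff_mem,
    Ideal.mem_span_singleton] at h3
  exact (pow_dvd_pow X (by have := hm r; omega)).trans h3

theorem isUnit_det_of_isUnit_psi {R : Type} [CommRing R] {n m : ℕ}
    {A : Matrix (Fin n) (Fin n) R⟦X⟧} (h : IsUnit (psi m A)) : IsUnit A.det := by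
  rw [Matrix.isUnit_iff_isUnit_det] at h
  have h1 : (psi m A).det = Ideal.Quotient.mk _ A.det := (RingHom.map_det _ A).symm
  rw [h1] at h
  have h2 := h.map (Ideal.Quotient.lift (Ideal.span {(X : R⟦X⟧) ^ (m + 1)}) constantCoeff
    fun f hf => by
      obtain ⟨g, rfl⟩ := Ideal.mem_span_singleton.1 hf
      simp)
  rwa [Ideal.Quotient.lift_mk, ← isUnit_iff_constantCoeff] at h2

theorem isUnit_psi {R : Type} [CommRing R] {n m : ℕ}
    {A : Matrix (Fin n) (Fin n) R⟦X⟧} (h : IsUnit A.det) : IsUnit (psi m A) :=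
  ((Matrix.isUnit_iff_isUnit_det A).2 h).map (RingHom.mapMatrix (Ideal.Quotient.mk _))

theorem mul_mem_contactJets {n m : ℕ} {lam : Fin n → ℕ} {x : Jet n m}
    (hx : x ∈ contactJets lam m) (g : Matrix.GeneralLinearGroup (Fin n) (TruncRing ℂ m)) :
    (g : Jet n m) * x ∈ contactJets lam m := by
  obtain ⟨A, hA, rfl⟩ := hx
  obtain ⟨B, hB⟩ := psi_surjective (g : Jet n m)
  refine ⟨B * A, (mul_mem_contactLocus_iff (isUnit_det_of_isUnit_psi (m := m) ?_)).2 hA, ?_⟩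
  · rw [hB]
    exact g.isUnit
  · rw [psi_mul, hB]

end Contact

open PowerSeries

/-! ### Coefficients and base change of normal forms -/

section NormalForm

variable {R : Type} [CommRing R] {n : ℕ} (lam : Fin n → ℕ) (c : NFIndex lam → R)

theorem normalForm_of_lt {i j : Fin n} (h : i < j) : normalForm lam c i j =
    ∑ k : Fin (pivot lam j), monomial (k : ℕ) (c ⟨⟨(i, j), h⟩, k⟩) := by
  rw [normalForm, Matrix.of_apply, dif_pos h]

theorem normalForm_diag (j : Fin n) : normalForm lam c j j = X ^ pivot lam j := by
  rw [normalForm, Matrix.of_apply, dif_neg (lt_irrefl j), if_pos rfl]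

theorem normalForm_of_gt {i j : Fin n} (h : j < i) : normalForm lam c i j = 0 := by
  rw [normalForm, Matrix.of_apply, dif_neg h.not_gt, if_neg h.ne']

theorem coeff_sum_monomial {a : ℕ} (v : Fin a → R) (k : ℕ) :
    coeff k (∑ l : Fin a, monomial (l : ℕ) (v l)) = if h : k < a then v ⟨k, h⟩ else 0 := by
  rw [map_sum]
  split_ifs with h
  · rw [Finset.sum_eq_single ⟨k, h⟩]
    · simp
    · intro b _ hb
      rw [coeff_monomial, if_neg]
      exact fun h => hb (Fin.ext h.symm)
    · simp
  · refine Finset.sum_eq_zero fun b _ => ?_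
    rw [coeff_monomial, if_neg]
    exact fun hk => h (hk ▸ b.2)

theorem sum_monomial_coeff {a : ℕ} {f : R⟦X⟧} (hf : ∀ k, a ≤ k → coeff k f = 0) :
    ∑ l : Fin a, monomial (l : ℕ) (coeff l f) = f := by
  ext k
  rw [coeff_sum_monomial]
  split_ifs with h
  · rfl
  · exact (hf k (not_lt.1 h)).symm

theorem coeff_normalForm {i j : Fin n} (h : i < j) (k : Fin (pivot lam j)) :
    coeff k (normalForm lam c i j) = c ⟨⟨(i, j), h⟩, k⟩ := by
  rw [normalForm_of_lt lam c h, coeff_sum_monomial, dif_pos k.2]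

theorem coeff_normalForm_of_le {i j : Fin n} (h : i < j) {k : ℕ} (hk : pivot lam j ≤ k) :
    coeff k (normalForm lam c i j) = 0 := by
  rw [normalForm_of_lt lam c h, coeff_sum_monomial, dif_neg (not_lt.2 hk)]

theorem map_normalForm {S : Type} [CommRing S] (f : R →+* S) :
    (normalForm lam c).map (PowerSeries.map f) = normalForm lam (f ∘ c) := by
  ext1 i j
  rw [Matrix.map_apply]
  rcases lt_trichotomy i j with h | rfl | h
  · rw [normalForm_of_lt _ _ h, normalForm_of_lt _ _ h, map_sum]
    exact Finset.sum_congr rfl fun k _ => by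
      ext l
      simp [coeff_monomial, apply_ite f]
  · rw [normalForm_diag, normalForm_diag, map_pow, map_X]
  · rw [normalForm_of_gt _ _ h, normalForm_of_gt _ _ h, map_zero]

theorem exists_normalForm_eq {A : Matrix (Fin n) (Fin n) R⟦X⟧} (hA : ∀ i j, j < i → A i j = 0)
    (hAd : ∀ j, A j j = X ^ pivot lam j)
    (hAr : ∀ i j, i < j → ∀ k, pivot lam j ≤ k → coeff k (A i j) = 0) :
    ∃ c, A = normalForm lam c := by
  refine ⟨fun e => coeff e.2 (A e.1.1.1 e.1.1.2), ?_⟩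
  ext1 i j
  rcases lt_trichotomy i j with h | rfl | h
  · rw [normalForm_of_lt _ _ h, sum_monomial_coeff (hAr i j h)]
  · rw [normalForm_diag, hAd]
  · rw [normalForm_of_gt _ _ h, hA _ _ h]

end NormalForm

/-! ### Sums of pivot exponents -/

section Pivot

/-- The part `λ_(n + 1 - k)`, where `λ_(n + 1) = 0`. -/
def colOrder {n : ℕ} (lam : Fin n → ℕ) (k : ℕ) : ℕ :=
  if h : 0 < k ∧ k ≤ n then lam ⟨n - k, by omega⟩ else 0

theorem colOrder_sub {n : ℕ} (lam : Fin n → ℕ) (r : Fin n) :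
    colOrder lam (n - r) = lam r := by
  rw [colOrder, dif_pos (by omega)]
  congr 1
  ext
  simp only
  omega

/-- Monotonicity is what makes the truncated subtraction in `gap` a true difference. -/
theorem colOrder_succ {n : ℕ} {lam : Fin n → ℕ} (hlam : Antitone lam) (j : Fin n) :
    colOrder lam (j + 1) = colOrder lam j + pivot lam j := by
  have h1 : colOrder lam (j + 1) = lam j.rev := by
    rw [colOrder, dif_pos (by omega)]
    rfl
  rw [h1, pivot, gap, colOrder]
  split_ifs with h2 h3 h3
  · have h4 : (⟨n - j, by omega⟩ : Fin n) = ⟨j.rev + 1, h3⟩ := by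
      ext
      simp only [Fin.val_rev]
      omega
    rw [h4]
    exact (Nat.add_sub_cancel' (hlam (Fin.le_def.2 (Nat.le_succ _)))).symm
  · rw [Fin.val_rev] at h3
    omega
  · rw [Fin.val_rev] at h3
    omega
  · simp

theorem pivot_le {n m : ℕ} {lam : Fin n → ℕ} (hlam : Antitone lam)
    (hm : ∀ k, colOrder lam k < m) (j : Fin n) : pivot lam j ≤ m := by
  have := colOrder_succ hlam j
  have := hm (j + 1)
  omega

theorem sum_pivot_castLE {n : ℕ} {lam : Fin n → ℕ} (hlam : Antitone lam) {k : ℕ} (hk : k ≤ n) :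
    ∑ a : Fin k, pivot lam (Fin.castLE hk a) = colOrder lam k := by
  induction k with
  | zero => simp [colOrder]
  | succ k ih =>
    rw [Fin.sum_univ_castSucc, colOrder_succ hlam ⟨k, hk⟩, ← ih (Nat.le_of_succ_le hk)]
    rfl

theorem colOrder_lt {n m : ℕ} {lam : Fin n → ℕ} (hm : ∀ i, lam i < m) (h0 : 0 < m) (k : ℕ) :
    colOrder lam k < m := by
  rw [colOrder]
  split_ifs
  · exact hm _
  · exact h0

theorem sum_pivot {n : ℕ} {lam : Fin n → ℕ} (hlam : Antitone lam) :
    ∑ j, pivot lam j = colOrder lam n :=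
  sum_pivot_castLE hlam le_rfl

theorem sum_pivot_lt {n : ℕ} {lam : Fin n → ℕ} (hlam : Antitone lam) (j : Fin n) :
    ∑ i : {i : Fin n // i < j}, pivot lam i = colOrder lam j := by
  rw [← sum_pivot_castLE hlam j.2.le]
  exact (Fintype.sum_equiv
    { toFun := fun a : Fin j => (⟨Fin.castLE j.2.le a, a.2⟩ : {i : Fin n // i < j})
      invFun := fun i => ⟨i.1, i.2⟩
      left_inv := fun _ => rfl
      right_inv := fun _ => rfl } _ _ fun _ => rfl).symm

end Pivot

/-! ### Hermite normal form of an arc in the contact locus -/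

section Hermite

variable {n : ℕ} {lam : Fin n → ℕ}

theorem normalForm_mem_contactLocus (hlam : Antitone lam) (c : NFIndex lam → ℂ) :
    normalForm lam c ∈ contactLocus lam := by
  refine mem_contactLocus_iff.2 fun r => ?_
  rw [minorsDvd_iff_of_upperTriangular fun i j => normalForm_of_gt lam c,
    minorsDvd_iff_of_upperTriangular fun i j => normalForm_of_gt lam c,
    Finset.prod_congr rfl fun a _ => normalForm_diag lam c _, Finset.prod_pow_eq_pow_sum,
    sum_pivot_castLE hlam, colOrder_sub]
  refine ⟨dvd_rfl, fun h => ?_⟩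
  rw [X_pow_dvd_iff] at h
  simpa using h (lam r) (Nat.lt_succ_self _)

variable {K : Type} [Field K]

theorem exists_dvd_of_nonempty {ι : Type} (s : Finset ι) (hs : s.Nonempty) (f : ι → K⟦X⟧) :
    ∃ r ∈ s, ∀ i ∈ s, f r ∣ f i := by
  induction hs using Finset.Nonempty.cons_induction with
  | singleton a => exact ⟨a, by simp, by simp⟩
  | cons a s ha hs ih =>
    obtain ⟨r, hr, h⟩ := ih
    rcases ValuationRing.dvd_total (f a) (f r) with h' | h'
    · refine ⟨a, by simp, fun i hi => ?_⟩
      rcases Finset.mem_cons.1 hi with rfl | hi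
      · exact dvd_rfl
      · exact h'.trans (h i hi)
    · refine ⟨r, by simp [hr], fun i hi => ?_⟩
      rcases Finset.mem_cons.1 hi with rfl | hi
      · exact h'
      · exact h i hi

/-- Gaussian elimination: divisibility is total in the valuation ring `K⟦X⟧`, so in each column some
candidate pivot divides the others. -/
theorem exists_upperTriangular (A : Matrix (Fin n) (Fin n) K⟦X⟧) :
    ∃ g : Matrix (Fin n) (Fin n) K⟦X⟧, IsUnit g.det ∧ ∀ i j, j < i → (g * A) i j = 0 := by
  suffices ∀ p ≤ n, ∃ g : Matrix (Fin n) (Fin n) K⟦X⟧, IsUnit g.det ∧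
      ∀ i j : Fin n, (j : ℕ) < p → j < i → (g * A) i j = 0 by
    obtain ⟨g, hg, h⟩ := this n le_rfl
    exact ⟨g, hg, fun i j => h i j j.2⟩
  intro p hp
  induction p with
  | zero => exact ⟨1, by simp, fun i j h => absurd h (Nat.not_lt_zero _)⟩
  | succ p ih =>
    obtain ⟨g, hg, h⟩ := ih (Nat.le_of_succ_le hp)
    let q : Fin n := ⟨p, hp⟩
    obtain ⟨r, hr, hdvd⟩ := exists_dvd_of_nonempty (Finset.univ.filter fun i => q ≤ i)
      ⟨q, by simp⟩ fun i => (g * A) i q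
    simp only [Finset.mem_filter, Finset.mem_univ, true_and] at hr hdvd
    let s : Equiv.Perm (Fin n) := Equiv.swap q r
    let B := (g * A).submatrix s id
    have hs : ∀ i, q ≤ i → q ≤ s i := by
      intro i hi
      simp only [s, Equiv.swap_apply_def]
      split_ifs
      · exact hr
      · exact le_rfl
      · exact hi
    have hBq : ∀ i, q ≤ i → B q q ∣ B i q := by
      intro i hi
      have : B q q = (g * A) r q := by simp [B, s]
      rw [this]
      exact hdvd _ (hs i hi)
    have hB0 : ∀ i j : Fin n, (j : ℕ) < p → j < i → B i j = 0 := by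
      intro i j hj hij
      by_cases hi : q ≤ i
      · exact h _ j hj (lt_of_lt_of_le (b := q) (Fin.lt_def.2 hj) (hs i hi))
      · have : s i = i := Equiv.swap_apply_of_ne_of_ne (fun h => hi h.ge)
          fun h => hi (h ▸ hr)
        change (g * A) (s i) j = 0
        rw [this]
        exact h i j hj hij
    choose f hf using fun i : {i // q ≤ i} => hBq i i.2
    -- A unipotent matrix that subtracts multiples of row `q` from the rows below, clearing column
    -- `q`.
    let T : Matrix (Fin n) (Fin n) K⟦X⟧ := Matrix.of fun i j =>
      if i = j then 1 else if hi : q < i then (if j = q then -f ⟨i, hi.le⟩ else 0) else 0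
    have hT : T.det = 1 := by
      rw [Matrix.det_of_isLowerTriangular T fun i j hij => ?_]
      · simp [T]
      · have hij : i < j := hij
        simp only [T, Matrix.of_apply]
        rw [if_neg hij.ne]
        split_ifs with h1 h2
        · exact absurd (h1.trans hij) (by simp [h2])
        · rfl
        · rfl
    have hTB : ∀ i j, (T * B) i j = B i j - if hi : q < i then f ⟨i, hi.le⟩ * B q j else 0 := by
      intro i j
      rw [Matrix.mul_apply]
      by_cases hi : q < i
      · have : ∀ l, T i l * B l j = (if i = l then B l j else 0) +
            (if l = q then -f ⟨i, hi.le⟩ * B l j else 0) := by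
          intro l
          simp only [T, Matrix.of_apply, dif_pos hi]
          by_cases hil : i = l
          · subst hil
            simp [hi.ne']
          · simp [hil]
        simp_rw [this]
        rw [Finset.sum_add_distrib]
        simp [hi, sub_eq_add_neg]
      · have : ∀ l, T i l * B l j = if i = l then B l j else 0 := by
          intro l
          simp only [T, Matrix.of_apply, dif_neg hi]
          simp
        simp_rw [this]
        simp [hi]
    refine ⟨T * (s.toPEquiv.toMatrix * g), ?_, fun i j hj hij => ?_⟩
    · rw [Matrix.det_mul, Matrix.det_mul, hT, one_mul]
      refine IsUnit.mul ?_ hg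
      rw [Matrix.det_permutation]
      exact (Units.isUnit _).map (Int.castRingHom K⟦X⟧)
    · have hBs : s.toPEquiv.toMatrix * g * A = B := by
        rw [Matrix.mul_assoc, PEquiv.toMatrix_toPEquiv_mul]
      rw [Matrix.mul_assoc, hBs, hTB]
      rcases (Nat.lt_succ_iff.1 hj).lt_or_eq with hj | hj
      · rw [hB0 i j hj hij, zero_sub, neg_eq_zero]
        split_ifs with hi
        · rw [hB0 q j hj (Fin.lt_def.2 hj), mul_zero]
        · rfl
      · have : j = q := Fin.ext hj
        subst this
        rw [dif_pos hij, hf ⟨i, hij.le⟩, mul_comm, sub_self]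

/-- The contact conditions give the order of each product of leading diagonal entries; consecutive
products are then compared. -/
theorem exists_unit_diag (hlam : Antitone lam) {B : Arc n} (hB : ∀ i j, j < i → B i j = 0)
    (hBl : B ∈ contactLocus lam) (j : Fin n) : ∃ u : ℂ⟦X⟧ˣ, B j j = (u : ℂ⟦X⟧) * X ^ pivot lam j := by
  have key : ∀ (k : ℕ) (hk : k ≤ n), ∃ u : ℂ⟦X⟧ˣ,
      ∏ a : Fin k, B (Fin.castLE hk a) (Fin.castLE hk a) = (u : ℂ⟦X⟧) * X ^ colOrder lam k := by
    intro k hk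
    rcases Nat.eq_zero_or_pos k with rfl | hk0
    · exact ⟨1, by simp [colOrder]⟩
    · obtain ⟨r, rfl⟩ : ∃ r : Fin n, k = n - r :=
        ⟨⟨n - k, by omega⟩, (Nat.sub_sub_self hk).symm⟩
      have := mem_contactLocus_iff.1 hBl r
      rw [minorsDvd_iff_of_upperTriangular hB, minorsDvd_iff_of_upperTriangular hB] at this
      rw [colOrder_sub]
      exact exists_unit_mul_X_pow this.1 this.2
  obtain ⟨u, hu⟩ := key j j.2.le
  obtain ⟨v, hv⟩ := key (j + 1) j.2
  rw [Fin.prod_univ_castSucc] at hv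
  change (∏ a : Fin j, B (Fin.castLE j.2.le a) (Fin.castLE j.2.le a)) * B j j = _ at hv
  rw [hu, colOrder_succ hlam, add_comm, pow_add] at hv
  refine ⟨u⁻¹ * v, X_pow_mul_cancel (k := colOrder lam j) ?_⟩
  rw [Units.val_mul, mul_assoc, mul_assoc, ← hv, mul_assoc, Units.inv_mul_cancel_left, mul_comm]

theorem exists_mul_eq_normalForm (hlam : Antitone lam) {A : Arc n} (hA : A ∈ contactLocus lam) :
    ∃ g : Arc n, IsUnit g.det ∧ ∃ c, g * A = normalForm lam c := by
  obtain ⟨g, hg, htri⟩ := exists_upperTriangular A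
  choose u hu using exists_unit_diag hlam htri ((mul_mem_contactLocus_iff hg).2 hA)
  let D : Arc n := Matrix.diagonal fun j => ((u j)⁻¹ : ℂ⟦X⟧ˣ)
  let B : Arc n := D * (g * A)
  have hD : IsUnit D.det := by
    rw [Matrix.det_diagonal, ← Units.coe_prod]
    exact Units.isUnit _
  have hBa : ∀ i j, B i j = ((u i)⁻¹ : ℂ⟦X⟧ˣ) * (g * A) i j := fun i j =>
    Matrix.diagonal_mul _ _ _ _
  have hB : ∀ i j, j < i → B i j = 0 := fun i j h => by rw [hBa, htri i j h, mul_zero]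
  have hBd : ∀ j, B j j = X ^ pivot lam j := fun j => by
    rw [hBa, hu, Units.inv_mul_cancel_left]
  -- Only the part above the diagonal is reduced, so `1 - e` is unipotent and leaves the diagonal
  -- alone.
  choose e he using fun i => exists_row_reduction hB hBd fun j => if j ≤ i then 0 else B i j
  have he0 : ∀ i j, j ≤ i → e i j = 0 := fun i j hj =>
    quotient_eq_zero hB hBd (he i) (p := i) (fun j hj => if_pos hj) j hj
  have hUdet : (1 - Matrix.of e).det = 1 := by
    rw [Matrix.det_of_isUpperTriangular fun i j hij => ?_]
    · simp [he0]
    · have hij : j < i := hij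
      simp [Matrix.one_apply_ne hij.ne', he0 i j hij.le]
  have hUB : ∀ i j, ((1 - Matrix.of e) * B) i j = B i j - ∑ l, e i l * B l j := fun i j => by
    rw [Matrix.sub_mul, Matrix.one_mul, Matrix.sub_apply, Matrix.mul_apply]
    rfl
  have hsum : ∀ i j, j ≤ i → ∑ l, e i l * B l j = 0 := fun i j hj =>
    Finset.sum_eq_zero fun l _ => by
      rcases le_or_gt l i with hl | hl
      · rw [he0 i l hl, zero_mul]
      · rw [hB l j (hj.trans_lt hl), mul_zero]
  refine ⟨(1 - Matrix.of e) * D * g, ?_, ?_⟩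
  · rw [Matrix.det_mul, Matrix.det_mul, hUdet, one_mul]
    exact hD.mul hg
  · have : (1 - Matrix.of e) * D * g * A = (1 - Matrix.of e) * B := by
      simp only [B, Matrix.mul_assoc]
    rw [this]
    refine exists_normalForm_eq lam (fun i j h => ?_) (fun j => ?_) fun i j h k hk => ?_
    · rw [hUB, hB i j h, hsum i j h.le, sub_zero]
    · rw [hUB, hBd, hsum j j le_rfl, sub_zero]
    · rw [hUB]
      have := he i j k hk
      rwa [if_neg h.not_ge] at this

theorem mem_contactJets_iff (hlam : Antitone lam) {m : ℕ} {x : Jet n m} :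
    x ∈ contactJets lam m ↔
      ∃ (g : Arc n) (c : NFIndex lam → ℂ), IsUnit g.det ∧ x = psi m (g * normalForm lam c) := by
  constructor
  · rintro ⟨A, hA, rfl⟩
    obtain ⟨g, hg, c, h⟩ := exists_mul_eq_normalForm hlam hA
    refine ⟨g⁻¹, c, Matrix.isUnit_nonsing_inv_det _ hg, ?_⟩
    rw [← h, ← Matrix.mul_assoc, Matrix.nonsing_inv_mul _ hg, Matrix.one_mul]
  · rintro ⟨g, c, hg, rfl⟩
    exact ⟨_, (mul_mem_contactLocus_iff hg).2 (normalForm_mem_contactLocus hlam c), rfl⟩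

end Hermite

/-! ### Canonical representatives of the left factor -/

section Representative

variable {R : Type} [CommRing R] {n : ℕ} (lam : Fin n → ℕ) (m : ℕ)

/-- The coefficients of the matrices whose `j`-th column has degree at most
`m - pivot lam j`. -/
abbrev RepIndex {n : ℕ} (lam : Fin n → ℕ) (m : ℕ) : Type :=
  Σ q : Fin n × Fin n, Fin (m + 1 - pivot lam q.2)

/-- The matrix of polynomials with given coefficients, the `j`-th column having degree at most
`m - pivot lam j`. -/
noncomputable def repMatrix (v : RepIndex lam m → R) : Matrix (Fin n) (Fin n) R⟦X⟧ :=
  Matrix.of fun i j => ∑ k : Fin (m + 1 - pivot lam j), monomial (k : ℕ) (v ⟨(i, j), k⟩)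

variable {lam m}

theorem coeff_repMatrix (v : RepIndex lam m → R) (q : RepIndex lam m) :
    coeff q.2 (repMatrix lam m v q.1.1 q.1.2) = v q := by
  rw [repMatrix, Matrix.of_apply, coeff_sum_monomial, dif_pos q.2.2]

theorem coeff_repMatrix_of_le (v : RepIndex lam m → R) (i j : Fin n) (k : ℕ)
    (hk : m + 1 - pivot lam j ≤ k) : coeff k (repMatrix lam m v i j) = 0 := by
  rw [repMatrix, Matrix.of_apply, coeff_sum_monomial, dif_neg (not_lt.2 hk)]

theorem exists_repMatrix_eq {A : Matrix (Fin n) (Fin n) R⟦X⟧}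
    (hA : ∀ i j k, m + 1 - pivot lam j ≤ k → coeff k (A i j) = 0) :
    ∃ v, repMatrix lam m v = A := by
  refine ⟨fun q => coeff q.2 (A q.1.1 q.1.2), ?_⟩
  ext1 i j
  exact sum_monomial_coeff (hA i j)

theorem map_repMatrix {S : Type} [CommRing S] (f : R →+* S) (v : RepIndex lam m → R) :
    (repMatrix lam m v).map (PowerSeries.map f) = repMatrix lam m (f ∘ v) := by
  ext i j k
  rw [Matrix.map_apply, coeff_map, repMatrix, repMatrix, Matrix.of_apply, Matrix.of_apply,
    coeff_sum_monomial, coeff_sum_monomial]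
  split_ifs
  · rfl
  · exact map_zero f

theorem exists_repMatrix (hlam : Antitone lam) (hm : colOrder lam n < m)
    (c : NFIndex lam → R) (V : Matrix (Fin n) (Fin n) R⟦X⟧) :
    ∃ v, psi m (V * normalForm lam c) = psi m (repMatrix lam m v * normalForm lam c) ∧
      ∀ i j, constantCoeff (repMatrix lam m v i j) = constantCoeff (V i j) := by
  obtain ⟨W, h1, h2, h3⟩ := exists_representative (fun i j => normalForm_of_gt lam c)
    (normalForm_diag lam c) (N := m + 1) (by rw [sum_pivot hlam]; omega) V
  obtain ⟨v, rfl⟩ := exists_repMatrix_eq h1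
  exact ⟨v, psi_eq_psi_iff.2 h2, h3⟩

theorem isUnit_det_iff_of_constantCoeff_eq {A B : Matrix (Fin n) (Fin n) R⟦X⟧}
    (h : ∀ i j, constantCoeff (A i j) = constantCoeff (B i j)) :
    IsUnit A.det ↔ IsUnit B.det := by
  rw [isUnit_iff_constantCoeff, isUnit_iff_constantCoeff, RingHom.map_det, RingHom.map_det]
  have : constantCoeff.mapMatrix A = constantCoeff.mapMatrix B := by
    ext i j
    exact h i j
  rw [this]

end Representative

/-! ### Functor of points of affine spaces and basic open sets -/

section Points

/-- Pullback of global functions. -/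
noncomputable def pullFun {T T' : Over SpecC} (f : T' ⟶ T) : Γ(T.left, ⊤) →+* Γ(T'.left, ⊤) :=
  f.left.appTop.hom

theorem pullFun_comp {T T' T'' : Over SpecC} (g : T'' ⟶ T') (f : T' ⟶ T) :
    pullFun (g ≫ f) = (pullFun g).comp (pullFun f) := by
  simp only [pullFun, Over.comp_left, Scheme.Hom.comp_appTop, CommRingCat.hom_comp]

theorem affineHomEquiv_comp {σ : Type} {T T' : Over SpecC} (f : T' ⟶ T) (x : T ⟶ affineOver σ) :
    affineHomEquiv σ T' (f ≫ x) = pullFun f ∘ affineHomEquiv σ T x := by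
  funext s
  change (f ≫ x).left.appTop.hom (coordFun s) = pullFun f (x.left.appTop.hom (coordFun s))
  exact congrArg (fun g : _ →+* _ => g (coordFun s)) (pullFun_comp f x)

theorem comp_affineHomEquiv_symm {σ : Type} {T T' : Over SpecC} (f : T' ⟶ T)
    (v : σ → Γ(T.left, ⊤)) :
    f ≫ (affineHomEquiv σ T).symm v = (affineHomEquiv σ T').symm (pullFun f ∘ v) := by
  rw [Equiv.eq_symm_apply, affineHomEquiv_comp, Equiv.apply_symm_apply]

theorem pullFun_coordFun {σ : Type} {T : Over SpecC} (x : T ⟶ affineOver σ) (s : σ) :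
    pullFun x (coordFun s) = affineHomEquiv σ T x s := rfl

variable (X : Over SpecC) (F : Γ(X.left, ⊤))

/-- The open subscheme where a function is invertible. -/
noncomputable def basicOver : Over SpecC := Over.mk ((X.left.basicOpen F).ι ≫ X.hom)

noncomputable def basicIncl : basicOver X F ⟶ X := Over.homMk (X.left.basicOpen F).ι rfl

instance : IsOpenImmersion (basicIncl X F).left :=
  inferInstanceAs (IsOpenImmersion (X.left.basicOpen F).ι)

variable {X F}

theorem isUnit_of_basicOpen_eq_top {Y : Scheme.{0}} {f : Γ(Y, ⊤)} (h : Y.basicOpen f = ⊤) :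
    IsUnit f :=
  RingedSpace.isUnit_of_isUnit_germ Y.toRingedSpace ⊤ f fun x _ =>
    (Y.mem_basicOpen_top f x).1 (h.symm ▸ TopologicalSpace.Opens.mem_top x)

theorem isUnit_pullFun_basicIncl : IsUnit (pullFun (basicIncl X F) F) := by
  have h : (X.left.basicOpen F).ι ⁻¹ᵁ X.left.basicOpen F = ⊤ := Scheme.Opens.ι_preimage_self _
  rw [Scheme.preimage_basicOpen_top] at h
  exact isUnit_of_basicOpen_eq_top h

theorem isUnit_pullFun {T : Over SpecC} (y : T ⟶ basicOver X F) :
    IsUnit (pullFun (y ≫ basicIncl X F) F) := by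
  rw [pullFun_comp]
  exact (isUnit_pullFun_basicIncl (X := X) (F := F)).map (pullFun y)

theorem exists_comp_basicIncl {T : Over SpecC} (x : T ⟶ X) (h : IsUnit (pullFun x F)) :
    ∃ y : T ⟶ basicOver X F, y ≫ basicIncl X F = x := by
  have hr : Set.range x.left ⊆ Set.range (X.left.basicOpen F).ι := by
    have : x.left ⁻¹ᵁ (X.left.basicOpen F) = ⊤ := by
      rw [Scheme.preimage_basicOpen_top]
      exact Scheme.basicOpen_of_isUnit _ h
    rw [Scheme.Opens.range_ι]
    rintro _ ⟨t, rfl⟩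
    have ht : t ∈ x.left ⁻¹ᵁ (X.left.basicOpen F) := this ▸ trivial
    exact ht
  let y : T.left ⟶ X.left.basicOpen F := IsOpenImmersion.lift (X.left.basicOpen F).ι x.left hr
  have hy : y ≫ (X.left.basicOpen F).ι = x.left := IsOpenImmersion.lift_fac _ _ _
  have hyX : y ≫ (X.left.basicOpen F).ι ≫ X.hom = T.hom := by
    rw [← Category.assoc, hy, Over.w]
  exact ⟨Over.homMk y hyX, Over.OverMorphism.ext hy⟩

instance mono_basicIncl : Mono (basicIncl X F) := by
  have : Mono (basicIncl X F).left := inferInstance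
  exact Over.mono_of_mono_left _

end Points

/-! ### Smoothness and surjectivity criteria -/

section Smooth

/-- Affine space is a base change of the spectrum of a polynomial ring over the integers. -/
theorem smooth_affineSpace (σ : Type) [Finite σ] (S : Scheme.{0}) : Smooth (𝔸(σ; S) ↘ S) := by
  have h : Smooth (Limits.terminal.from (Spec (.of (MvPolynomial σ (ULift.{0} ℤ))))) := by
    have := Limits.isIso_of_isTerminal specULiftZIsTerminal.{0} Limits.terminalIsTerminal
      (Limits.terminal.from _)
    have hC : Smooth (Spec.map (CommRingCat.ofHom
        (MvPolynomial.C (R := ULift.{0} ℤ) (σ := σ)))) := by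
      rw [HasRingHomProperty.Spec_iff (P := @Smooth), CommRingCat.hom_ofHom]
      have h : Algebra.Smooth (ULift.{0} ℤ) (MvPolynomial σ (ULift.{0} ℤ)) := ⟨inferInstance, inferInstance⟩
      exact RingHom.smooth_algebraMap.2 h
    rw [← Limits.terminal.comp_from (Spec.map (CommRingCat.ofHom MvPolynomial.C))]
    exact smooth_comp _ _
  exact MorphismProperty.of_isPullback (IsPullback.of_hasPullback _ _).flip h

theorem smooth_fst_affineOver (Y : Over SpecC) (σ : Type) [Finite σ] :
    Smooth (fst Y (affineOver σ)).left := by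
  have : Smooth (affineOver σ).hom := smooth_affineSpace σ SpecC
  rw [Over.fst_left]
  infer_instance

/-- A morphism with fibres affine spaces is smooth. -/
theorem smooth_of_bijective {X Y : Over SpecC} {σ : Type} [Finite σ] (f : X ⟶ Y)
    (k : X ⟶ affineOver σ)
    (h : ∀ (T : Over SpecC) (y : T ⟶ Y) (v : T ⟶ affineOver σ),
      ∃! x : T ⟶ X, x ≫ f = y ∧ x ≫ k = v) : Smooth f.left := by
  -- By Yoneda the hypothesis identifies `X` with the product of `Y` and an affine space.
  have hiso : IsIso (lift f k) := by
    refine isIso_of_yoneda_map_bijective _ fun T => ⟨fun x x' hx => ?_, fun y => ?_⟩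
    · refine (h T (x' ≫ f) (x' ≫ k)).unique ⟨?_, ?_⟩ ⟨rfl, rfl⟩
      · simpa using congrArg (· ≫ fst _ _) hx
      · simpa using congrArg (· ≫ snd _ _) hx
    · obtain ⟨x, ⟨h1, h2⟩, -⟩ := h T (y ≫ fst _ _) (y ≫ snd _ _)
      refine ⟨x, ?_⟩
      simp only [comp_lift, h1, h2]
      ext1 <;> simp
  have : Smooth (fst Y (affineOver σ)).left := smooth_fst_affineOver Y σ
  have hf : f.left = (lift f k).left ≫ (fst Y (affineOver σ)).left := by
    rw [← Over.comp_left, lift_fst]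
  rw [hf]
  have : IsIso (lift f k).left := (Over.forget _).map_isIso (lift f k)
  exact smooth_comp _ _

theorem surjective_of_section {X Y : Over SpecC} (f : X ⟶ Y) (s : Y ⟶ X) (h : s ≫ f = 𝟙 Y) :
    Surjective f.left := by
  have h' : s.left ≫ f.left = 𝟙 Y.left := by rw [← Over.comp_left, h, Over.id_left]
  have : Surjective (s.left ≫ f.left) := h' ▸ inferInstance
  exact Surjective.of_comp s.left f.left

end Smooth

/-! ### Immersions checked near the image -/

section Immersion

/-- The opens need only cover the image: `f` factors through their union, where being an immersion
is local on the target. -/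
theorem isImmersion_of_restrict {X Y : Scheme.{0}} (f : X ⟶ Y) {ι : Type} (W : ι → Y.Opens)
    (hW : ∀ x : X, ∃ i, f x ∈ W i) (h : ∀ i, IsImmersion (f ∣_ W i)) : IsImmersion f := by
  let U : Y.Opens := ⨆ i, W i
  have hr : Set.range f ⊆ Set.range U.ι := by
    rw [Scheme.Opens.range_ι]
    rintro _ ⟨x, rfl⟩
    obtain ⟨i, hi⟩ := hW x
    exact TopologicalSpace.Opens.mem_iSup.2 ⟨i, hi⟩
  let g : X ⟶ U := IsOpenImmersion.lift U.ι f hr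
  have hg : g ≫ U.ι = f := IsOpenImmersion.lift_fac _ _ _
  have : IsImmersion g := by
    refine (IsZariskiLocalAtTarget.iff_of_iSup_eq_top (P := @IsImmersion)
      (fun i => U.ι ⁻¹ᵁ W i) ?_).2 fun i => ?_
    · rw [← Scheme.Hom.preimage_iSup]
      exact Scheme.Opens.ι_preimage_self U
    · have : IsImmersion ((g ∣_ U.ι ⁻¹ᵁ W i) ≫ (U.ι ∣_ W i)) := by
        rw [← morphismRestrict_comp]
        have := h i
        rw [← hg] at this
        exact this
      exact IsImmersion.of_comp _ (U.ι ∣_ W i)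
  rw [← hg]
  infer_instance

end Immersion

/-! ### Jets as matrices of power series over global functions -/

section JetPoints

variable {n m : ℕ} {T T' : Over SpecC}

/-- The point of the jet scheme given by a matrix of power series. -/
noncomputable def jetHom (m : ℕ) (A : Matrix (Fin n) (Fin n) Γ(T.left, ⊤)⟦X⟧) : T ⟶ jetMat n m :=
  (jetMatEquiv n m T).symm (psi m A)

theorem jetHom_eq_iff {A B : Matrix (Fin n) (Fin n) Γ(T.left, ⊤)⟦X⟧} :
    jetHom m A = jetHom m B ↔ psi m A = psi m B :=
  (jetMatEquiv n m T).symm.injective.eq_iff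

theorem affineHomEquiv_jetHom (A : Matrix (Fin n) (Fin n) Γ(T.left, ⊤)⟦X⟧)
    (q : Fin n × Fin n × Fin (m + 1)) :
    affineHomEquiv _ T (jetHom m A) q = coeff (q.2.2 : ℕ) (A q.1 q.2.1) := by
  change affineHomEquiv _ T ((affineHomEquiv _ T).symm _) q = _
  rw [Equiv.apply_symm_apply]
  rfl

theorem jetHom_eq_of_affineHomEquiv {A : Matrix (Fin n) (Fin n) Γ(T.left, ⊤)⟦X⟧}
    {x : T ⟶ jetMat n m}
    (h : ∀ i j (k : Fin (m + 1)), affineHomEquiv _ T x (i, j, k) = coeff (k : ℕ) (A i j)) :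
    jetHom m A = x := by
  refine (affineHomEquiv _ T).injective ?_
  funext q
  rw [affineHomEquiv_jetHom]
  exact (h _ _ _).symm

theorem exists_jetHom_eq (x : T ⟶ jetMat n m) :
    ∃ A, jetHom m A = x ∧ ∀ i j k, m + 1 ≤ k → coeff k (A i j) = 0 := by
  refine ⟨Matrix.of fun i j => ∑ k : Fin (m + 1),
    monomial (k : ℕ) (affineHomEquiv _ T x (i, j, k)), ?_, fun i j k hk => ?_⟩
  · refine jetHom_eq_of_affineHomEquiv fun i j k => ?_
    rw [Matrix.of_apply, coeff_sum_monomial, dif_pos k.2]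
  · rw [Matrix.of_apply, coeff_sum_monomial, dif_neg (not_lt.2 hk)]

theorem comp_jetHom (f : T' ⟶ T) (A : Matrix (Fin n) (Fin n) Γ(T.left, ⊤)⟦X⟧) :
    f ≫ jetHom m A = jetHom m (A.map (PowerSeries.map (pullFun f))) := by
  refine (jetHom_eq_of_affineHomEquiv fun i j k => ?_).symm
  refine (congrFun (affineHomEquiv_comp (σ := Fin n × Fin n × Fin (m + 1)) f (jetHom m A))
    (i, j, k)).trans ?_
  rw [Function.comp_apply, affineHomEquiv_jetHom, Matrix.map_apply, coeff_map]

theorem jetMul_jetHom {g : T ⟶ jetGL n m} {G A : Matrix (Fin n) (Fin n) Γ(T.left, ⊤)⟦X⟧}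
    (hg : jetHom m G = g ≫ jetGLIncl n m) :
    jetMul g (jetHom m A) = jetHom m (G * A) := by
  rw [jetMul, ← hg, jetHom, jetHom, jetHom, Equiv.apply_symm_apply, Equiv.apply_symm_apply,
    psi_mul]

theorem pullFun_det_coordFun {σ : Type} (x : T ⟶ affineOver σ) (f : Fin n → Fin n → σ) :
    pullFun x (Matrix.of fun i j => coordFun (f i j)).det =
      (Matrix.of fun i j => affineHomEquiv _ T x (f i j)).det := by
  rw [RingHom.map_det]
  rfl

theorem pullFun_det_jetHom (G : Matrix (Fin n) (Fin n) Γ(T.left, ⊤)⟦X⟧) :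
    pullFun (jetHom m G) (Matrix.of fun i j : Fin n =>
      (coordFun (i, j, 0) : Γ((affineOver (Fin n × Fin n × Fin (m + 1))).left, ⊤))).det =
      constantCoeff G.det := by
  refine (pullFun_det_coordFun (jetHom m G) fun i j => (i, j, 0)).trans ?_
  rw [RingHom.map_det]
  congr 1
  ext i j
  rw [Matrix.of_apply, affineHomEquiv_jetHom]
  simp

theorem isUnit_det_of_jetGL {g : T ⟶ jetGL n m} {G : Matrix (Fin n) (Fin n) Γ(T.left, ⊤)⟦X⟧}
    (hg : jetHom m G = g ≫ jetGLIncl n m) : IsUnit G.det := by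
  rw [isUnit_iff_constantCoeff, ← pullFun_det_jetHom (m := m), hg]
  exact isUnit_pullFun (X := jetMat n m) g

theorem exists_jetGL {G : Matrix (Fin n) (Fin n) Γ(T.left, ⊤)⟦X⟧} (h : IsUnit G.det) :
    ∃ g : T ⟶ jetGL n m, g ≫ jetGLIncl n m = jetHom m G := by
  refine exists_comp_basicIncl (X := jetMat n m) (jetHom m G) ?_
  rw [isUnit_iff_constantCoeff, ← pullFun_det_jetHom (m := m)] at h
  exact h

instance : Mono (jetGLIncl n m) := mono_basicIncl (X := jetMat n m)

end JetPoints

/-! ### The parameter space and its map to jets -/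

section OrbitSpace

variable {n : ℕ} (lam : Fin n → ℕ) (m : ℕ)

/-- The space of pairs of an invertible matrix of polynomials, with `j`-th column of degree at
most `m - pivot lam j`, and of a normal form. -/
noncomputable def orbitSpace : Over SpecC :=
  basicOver (affineOver (RepIndex lam m ⊕ NFIndex lam))
    (constantCoeff (repMatrix lam m fun q => coordFun (Sum.inl q)).det)

noncomputable def orbitSpaceIncl :
    orbitSpace lam m ⟶ affineOver (RepIndex lam m ⊕ NFIndex lam) := basicIncl _ _

variable {lam m} {T T' : Over SpecC}

/-- The first component of a point of `orbitSpace lam m`. -/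
noncomputable def repCoord (y : T ⟶ orbitSpace lam m) (q : RepIndex lam m) : Γ(T.left, ⊤) :=
  affineHomEquiv _ T (y ≫ orbitSpaceIncl lam m) (Sum.inl q)

/-- The second component of a point of `orbitSpace lam m`. -/
noncomputable def nfCoord (y : T ⟶ orbitSpace lam m) (e : NFIndex lam) : Γ(T.left, ⊤) :=
  affineHomEquiv _ T (y ≫ orbitSpaceIncl lam m) (Sum.inr e)

theorem repCoord_comp (f : T' ⟶ T) (y : T ⟶ orbitSpace lam m) :
    repCoord (f ≫ y) = pullFun f ∘ repCoord y := by
  funext q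
  rw [repCoord, Category.assoc, affineHomEquiv_comp]
  rfl

theorem nfCoord_comp (f : T' ⟶ T) (y : T ⟶ orbitSpace lam m) :
    nfCoord (f ≫ y) = pullFun f ∘ nfCoord y := by
  funext q
  rw [nfCoord, Category.assoc, affineHomEquiv_comp]
  rfl

theorem pullFun_det_repMatrix (x : T ⟶ affineOver (RepIndex lam m ⊕ NFIndex lam)) :
    pullFun x (constantCoeff (repMatrix lam m fun q => coordFun (Sum.inl q)).det) =
      constantCoeff (repMatrix lam m fun q => affineHomEquiv _ T x (Sum.inl q)).det := by
  have : repMatrix lam m (fun q => affineHomEquiv _ T x (Sum.inl q)) =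
      (PowerSeries.map (pullFun x)).mapMatrix (repMatrix lam m fun q => coordFun (Sum.inl q)) := by
    rw [RingHom.mapMatrix_apply, map_repMatrix]
    rfl
  rw [this, ← RingHom.map_det, ← coeff_zero_eq_constantCoeff_apply,
    ← coeff_zero_eq_constantCoeff_apply, coeff_map]

theorem isUnit_det_repCoord (y : T ⟶ orbitSpace lam m) :
    IsUnit (repMatrix lam m (repCoord y)).det := by
  rw [isUnit_iff_constantCoeff]
  have := isUnit_pullFun y
  rwa [pullFun_det_repMatrix] at this

theorem exists_orbitSpace_point {v : RepIndex lam m → Γ(T.left, ⊤)}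
    (hv : IsUnit (repMatrix lam m v).det) (c : NFIndex lam → Γ(T.left, ⊤)) :
    ∃ y : T ⟶ orbitSpace lam m, repCoord y = v ∧ nfCoord y = c := by
  obtain ⟨y, hy⟩ := exists_comp_basicIncl
    (F := constantCoeff (repMatrix lam m fun q => coordFun (Sum.inl q)).det)
    ((affineHomEquiv (RepIndex lam m ⊕ NFIndex lam) T).symm (Sum.elim v c)) (by
      rw [pullFun_det_repMatrix, Equiv.apply_symm_apply, ← isUnit_iff_constantCoeff]
      exact hv)
  have h : affineHomEquiv _ T (y ≫ orbitSpaceIncl lam m) = Sum.elim v c := by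
    rw [orbitSpaceIncl, hy, Equiv.apply_symm_apply]
  refine ⟨y, ?_, ?_⟩
  · funext q
    exact congrFun h (Sum.inl q)
  · funext q
    exact congrFun h (Sum.inr q)

variable (lam m)

/-- The product of the two components of a point, as a jet. -/
noncomputable def orbitIncl : orbitSpace lam m ⟶ jetMat n m :=
  jetHom m (repMatrix lam m (repCoord (𝟙 _)) * normalForm lam (nfCoord (𝟙 _)))

variable {lam m}

theorem map_mul_normalForm {R S : Type} [CommRing R] [CommRing S] (f : R →+* S)
    (V : Matrix (Fin n) (Fin n) R⟦X⟧) (c : NFIndex lam → R) :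
    (V * normalForm lam c).map (PowerSeries.map f) =
      V.map (PowerSeries.map f) * normalForm lam (f ∘ c) := by
  rw [Matrix.map_mul, map_normalForm]

theorem comp_orbitIncl (y : T ⟶ orbitSpace lam m) :
    y ≫ orbitIncl lam m =
      jetHom m (repMatrix lam m (repCoord y) * normalForm lam (nfCoord y)) := by
  rw [orbitIncl, comp_jetHom, map_mul_normalForm, map_repMatrix, ← repCoord_comp,
    ← nfCoord_comp, Category.comp_id]

theorem exists_comp_orbitIncl (hlam : Antitone lam) (hm : colOrder lam n < m)
    {V : Matrix (Fin n) (Fin n) Γ(T.left, ⊤)⟦X⟧} (hV : IsUnit V.det)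
    (c : NFIndex lam → Γ(T.left, ⊤)) :
    ∃ y : T ⟶ orbitSpace lam m, nfCoord y = c ∧
      y ≫ orbitIncl lam m = jetHom m (V * normalForm lam c) := by
  obtain ⟨v, h1, h2⟩ := exists_repMatrix hlam hm c V
  obtain ⟨y, hyv, hyc⟩ := exists_orbitSpace_point
    ((isUnit_det_iff_of_constantCoeff_eq h2).2 hV) c
  exact ⟨y, hyc, by rw [comp_orbitIncl, hyv, hyc, jetHom_eq_iff, h1]⟩

end OrbitSpace

/-! ### The parameter space is immersed in the jet scheme -/

section MinorFun

/-- If all these minors were nonunits, the expansion of the determinant of an identity block of `M⁻¹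
* M` would put `1` in the maximal ideal. -/
theorem exists_isUnit_det_submatrix {R : Type} [CommRing R] [IsLocalRing R] {n : ℕ}
    {M : Matrix (Fin n) (Fin n) R} (hM : IsUnit M.det) {ι : Type} [Fintype ι] [DecidableEq ι]
    {e : ι → Fin n} (he : Function.Injective e) :
    ∃ φ : ι → Fin n, IsUnit (M.submatrix φ e).det := by
  by_contra! h
  have h1 : (M⁻¹.submatrix e id * M.submatrix id e).det ∈ IsLocalRing.maximalIdeal R :=
    det_mul_mem _ _ _ fun φ => (IsLocalRing.mem_maximalIdeal _).2 (h φ)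
  have h2 : M⁻¹.submatrix e id * M.submatrix id e = 1 := by
    have : M⁻¹.submatrix e id * M.submatrix id e = (M⁻¹ * M).submatrix e e :=
      Matrix.submatrix_mul_equiv _ _ _ (Equiv.refl _) _
    rw [this, Matrix.nonsing_inv_mul _ hM, Matrix.submatrix_one _ he]
  rw [h2, Matrix.det_one, IsLocalRing.mem_maximalIdeal] at h1
  exact h1 isUnit_one

theorem det_submatrix_mul_normalForm {R : Type} [CommRing R] {n : ℕ} {lam : Fin n → ℕ}
    (hlam : Antitone lam) (H : Matrix (Fin n) (Fin n) R⟦X⟧) (c : NFIndex lam → R) (j : Fin n)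
    (φ : {i // i < j} → Fin n) :
    ((H * normalForm lam c).submatrix φ Subtype.val).det =
      (H.submatrix φ Subtype.val).det * X ^ colOrder lam j := by
  have h1 : (H * normalForm lam c).submatrix φ (Subtype.val : {i // i < j} → Fin n) =
      H.submatrix φ (Subtype.val : {i // i < j} → Fin n) *
        (normalForm lam c).submatrix (Subtype.val : {i // i < j} → Fin n)
          (Subtype.val : {i // i < j} → Fin n) := by
    ext1 a b
    simp only [Matrix.submatrix_apply, Matrix.mul_apply]
    rw [← Finset.sum_subtype (Finset.univ.filter (· < j)) (by simp)
      fun l => H (φ a) l * normalForm lam c l b]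
    refine (Finset.sum_subset (Finset.subset_univ _) fun l _ hl => ?_).symm
    simp only [Finset.mem_filter, Finset.mem_univ, true_and, not_lt] at hl
    rw [normalForm_of_gt lam c (b.2.trans_le hl), mul_zero]
  have h2 : ((normalForm lam c).submatrix (Subtype.val : {i // i < j} → Fin n)
      Subtype.val).det = X ^ colOrder lam j := by
    have h : ((normalForm lam c).submatrix (Subtype.val : {i // i < j} → Fin n)
        Subtype.val).IsUpperTriangular := fun a b hab => normalForm_of_gt lam c hab
    rw [Matrix.det_of_isUpperTriangular h, ← sum_pivot_lt hlam, ← Finset.prod_pow_eq_pow_sum]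
    exact Finset.prod_congr rfl fun a _ => normalForm_diag lam c a
  rw [h1, Matrix.det_mul, h2]

variable {n : ℕ} (lam : Fin n → ℕ) (m : ℕ)

/-- The coefficient of a minor of the first columns of the universal jet. -/
noncomputable def minorFun (j : Fin n) (φ : {i // i < j} → Fin n) : Γ((jetMat n m).left, ⊤) :=
  coeff (colOrder lam j)
    ((exists_jetHom_eq (𝟙 (jetMat n m))).choose.submatrix φ Subtype.val).det

variable {lam m}

/-- A minor of the first `j` columns of `H * L` is that of `H` times `X ^ colOrder lam j`, and this
exponent survives truncation. Invertibility of minors of `H(0)` is thus an open condition on the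
jet. -/
theorem pullFun_minorFun (hlam : Antitone lam) (hm : ∀ k, colOrder lam k < m) {T : Over SpecC}
    (y : T ⟶ orbitSpace lam m) (j : Fin n) (φ : {i // i < j} → Fin n) :
    pullFun (y ≫ orbitIncl lam m) (minorFun lam m j φ) =
      constantCoeff ((repMatrix lam m (repCoord y)).submatrix φ Subtype.val).det := by
  have hU := (exists_jetHom_eq (𝟙 (jetMat n m))).choose_spec.1
  rw [minorFun]
  set U := (exists_jetHom_eq (𝟙 (jetMat n m))).choose
  have h1 : jetHom m (U.map (PowerSeries.map (pullFun (y ≫ orbitIncl lam m)))) =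
      jetHom m (repMatrix lam m (repCoord y) * normalForm lam (nfCoord y)) := by
    rw [← comp_orbitIncl, ← comp_jetHom, hU, Category.comp_id]
  have h2 := det_submatrix_sub_dvd (jetHom_eq_iff.1 h1) φ Subtype.val
  rw [X_pow_dvd_iff] at h2
  have h3 := h2 (colOrder lam j) ((hm j).trans (Nat.lt_succ_self m))
  rw [map_sub, sub_eq_zero, det_submatrix_mul_normalForm hlam, coeff_mul_X_pow',
    if_pos le_rfl, Nat.sub_self, coeff_zero_eq_constantCoeff_apply] at h3
  rw [← h3, ← coeff_map, RingHom.map_det]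
  rfl

/-- Over the open set where certain minors are invertible, the coordinates of a point of
`orbitSpace lam m` are functions of its image in the space of jets. -/
theorem exists_retraction (hlam : Antitone lam) (hm : ∀ k, colOrder lam k < m)
    (φ : ∀ j : Fin n, {i // i < j} → Fin n) {V W : Over SpecC} (g : V ⟶ W)
    (i : V ⟶ orbitSpace lam m) (u : W ⟶ jetMat n m) (h : i ≫ orbitIncl lam m = g ≫ u)
    (hu : ∀ j, IsUnit (pullFun u (minorFun lam m j (φ j)))) :
    ∃ r : W ⟶ affineOver (RepIndex lam m ⊕ NFIndex lam), g ≫ r = i ≫ orbitSpaceIncl lam m := by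
  obtain ⟨B, hB, -⟩ := exists_jetHom_eq u
  -- With the range of pullback as subring, each coordinate of the point comes from a function on
  -- `W`; chosen preimages define `r`.
  have key := coeff_mem_of_coeff_mul_mem (pullFun g).range
    (pivot_le hlam hm)
    (H := repMatrix lam m (repCoord i)) (fun _ _ => normalForm_of_gt lam (nfCoord i))
    (normalForm_diag lam _) (fun _ _ h _ hk => coeff_normalForm_of_le lam _ h hk)
    (coeff_repMatrix_of_le _) (fun a b k hk => ?_) φ fun j => ?_
  · choose v hv using fun q : RepIndex lam m => (key q.1.2 q.1.1 q.2).1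
    choose c hc using fun e : NFIndex lam => (key e.1.1.2 e.1.1.1 e.2).2
    refine ⟨(affineHomEquiv _ W).symm (Sum.elim v c), ?_⟩
    rw [comp_affineHomEquiv_symm, Equiv.symm_apply_eq]
    funext s
    rcases s with q | e
    · exact (hv q).trans (coeff_repMatrix _ q)
    · exact (hc e).trans (coeff_normalForm lam _ e.1.2 e.2)
  · rw [comp_orbitIncl, ← hB, comp_jetHom] at h
    have := congrArg (fun x => affineHomEquiv (Fin n × Fin n × Fin (m + 1)) V x
      (a, b, ⟨k, Nat.lt_succ_of_le hk⟩)) h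
    simp only [affineHomEquiv_jetHom] at this
    rw [this, Matrix.map_apply, coeff_map]
    exact ⟨_, rfl⟩
  · rw [← pullFun_minorFun hlam hm, h, pullFun_comp, RingHom.comp_apply]
    refine ⟨pullFun g ↑(hu j).unit⁻¹, ⟨_, rfl⟩, ?_⟩
    rw [← map_mul, IsUnit.val_inv_mul, map_one]

theorem isImmersion_orbitIncl (hlam : Antitone lam) (hm : ∀ k, colOrder lam k < m) :
    IsImmersion (orbitIncl lam m).left := by
  let F : (∀ j : Fin n, {i // i < j} → Fin n) → Γ((jetMat n m).left, ⊤) :=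
    fun φ => ∏ j, minorFun lam m j (φ j)
  refine isImmersion_of_restrict _ (fun φ => (jetMat n m).left.basicOpen (F φ))
    (fun x => ?_) fun φ => ?_
  · let ψ : Γ((orbitSpace lam m).left, ⊤) →+* (orbitSpace lam m).left.presheaf.stalk x :=
      ((orbitSpace lam m).left.presheaf.germ ⊤ x trivial).hom
    let M := (ψ.comp constantCoeff).mapMatrix (repMatrix lam m (repCoord (𝟙 _)))
    have hM : IsUnit M.det := by
      rw [← RingHom.map_det]
      exact (isUnit_det_repCoord (𝟙 _)).map _
    -- In the local ring at `x` the matrix `H(0)` is invertible, so for each `j` some minor of its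
    -- first columns is a unit.
    choose φ hφ using fun j : Fin n =>
      exists_isUnit_det_submatrix hM (Subtype.val_injective (p := fun i : Fin n => i < j))
    refine ⟨φ, ?_⟩
    have hx : (orbitIncl lam m).left x ∈ (jetMat n m).left.basicOpen (F φ) ↔
      x ∈ (orbitIncl lam m).left ⁻¹ᵁ (jetMat n m).left.basicOpen (F φ) := Iff.rfl
    rw [hx, Scheme.preimage_basicOpen_top, Scheme.mem_basicOpen_top]
    change IsUnit (ψ (pullFun (orbitIncl lam m) (F φ)))
    rw [map_prod, map_prod]
    have hunit : ∀ j, IsUnit (ψ (pullFun (orbitIncl lam m) (minorFun lam m j (φ j)))) := by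
      intro j
      have h1 := pullFun_minorFun hlam hm (𝟙 (orbitSpace lam m)) j (φ j)
      rw [Category.id_comp] at h1
      have h2 : (M.submatrix (φ j) Subtype.val).det = ψ (constantCoeff
          ((repMatrix lam m (repCoord (𝟙 _))).submatrix (φ j) Subtype.val).det) := by
        rw [← RingHom.comp_apply, RingHom.map_det]
        rfl
      rw [h1, ← h2]
      exact hφ j
    exact IsUnit.prod_univ_iff.2 hunit
  · let V := (orbitIncl lam m).left ⁻¹ᵁ (jetMat n m).left.basicOpen (F φ)
    let V' : Over SpecC := Over.mk (V.ι ≫ (orbitSpace lam m).hom)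
    let i : V' ⟶ orbitSpace lam m := Over.homMk V.ι rfl
    let f := (orbitIncl lam m).left ∣_ (jetMat n m).left.basicOpen (F φ)
    have hf : f ≫ ((jetMat n m).left.basicOpen (F φ)).ι = V.ι ≫ (orbitIncl lam m).left :=
      morphismRestrict_ι _ _
    have hw : f ≫ ((jetMat n m).left.basicOpen (F φ)).ι ≫ (jetMat n m).hom =
        V.ι ≫ (orbitSpace lam m).hom := by
      rw [← Category.assoc, hf, Category.assoc, Over.w]
    let g : V' ⟶ basicOver (jetMat n m) (F φ) := Over.homMk f hw
    have hg : i ≫ orbitIncl lam m = g ≫ basicIncl (jetMat n m) (F φ) :=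
      Over.OverMorphism.ext hf.symm
    obtain ⟨r, hr⟩ := exists_retraction hlam hm φ g i _ hg fun j => by
      have hF := isUnit_pullFun_basicIncl (X := jetMat n m) (F := F φ)
      exact isUnit_of_dvd_unit
        (map_dvd (pullFun (basicIncl (jetMat n m) (F φ)))
          (Finset.dvd_prod_of_mem (fun j => minorFun lam m j (φ j)) (Finset.mem_univ j))) hF
    have hr' : f ≫ r.left = V.ι ≫ (orbitSpaceIncl lam m).left :=
      congrArg CommaMorphism.left hr
    have h1 : IsOpenImmersion (orbitSpaceIncl lam m).left :=
      inferInstanceAs (IsOpenImmersion (basicIncl _ _).left)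
    -- This composite of open immersions factors as `f` followed by `r`, which forces `f` to be an
    -- immersion.
    have h2 : IsImmersion (V.ι ≫ (orbitSpaceIncl lam m).left) := inferInstance
    rw [← hr'] at h2
    exact IsImmersion.of_comp f r.left

theorem mono_orbitIncl (hlam : Antitone lam) (hm : ∀ k, colOrder lam k < m) :
    Mono (orbitIncl lam m) := by
  have := isImmersion_orbitIncl hlam hm
  have : Mono (orbitIncl lam m).left := inferInstance
  exact Over.mono_of_mono_left _

end MinorFun

/-! ### Projection, section, action and orbit map -/

section Maps

variable {n : ℕ} (lam : Fin n → ℕ) (m : ℕ)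

/-- The projection to the space of normal forms. -/
noncomputable def orbitProj : orbitSpace lam m ⟶ affineOver (NFIndex lam) :=
  (affineHomEquiv _ _).symm (nfCoord (𝟙 _))

variable {lam m}

theorem comp_orbitProj {T : Over SpecC} (y : T ⟶ orbitSpace lam m) :
    y ≫ orbitProj lam m = (affineHomEquiv _ _).symm (nfCoord y) := by
  rw [orbitProj, comp_affineHomEquiv_symm, ← nfCoord_comp, Category.comp_id]

theorem comp_orbitProj_eq_iff {T : Over SpecC} (y : T ⟶ orbitSpace lam m)
    (c : T ⟶ affineOver (NFIndex lam)) :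
    y ≫ orbitProj lam m = c ↔ nfCoord y = affineHomEquiv _ _ c := by
  rw [comp_orbitProj, Equiv.symm_apply_eq]

theorem smooth_affineOver_inr (σ τ : Type) [Finite σ] :
    Smooth ((affineHomEquiv τ (affineOver (σ ⊕ τ))).symm fun t => coordFun (Sum.inr t)).left := by
  refine smooth_of_bijective _
    ((affineHomEquiv σ (affineOver (σ ⊕ τ))).symm fun t => coordFun (Sum.inl t))
    fun T y v => ?_
  simp only [comp_affineHomEquiv_symm, Equiv.symm_apply_eq]
  refine ⟨(affineHomEquiv _ T).symm (Sum.elim (affineHomEquiv _ T v) (affineHomEquiv _ T y)),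
    ⟨?_, ?_⟩, fun x hx => ?_⟩
  · funext t
    rw [Function.comp_apply, pullFun_coordFun, Equiv.apply_symm_apply, Sum.elim_inr]
  · funext t
    rw [Function.comp_apply, pullFun_coordFun, Equiv.apply_symm_apply, Sum.elim_inl]
  · rw [Equiv.eq_symm_apply, ← hx.1, ← hx.2]
    funext t
    rcases t with t | t <;> rfl

theorem smooth_orbitProj : Smooth (orbitProj lam m).left := by
  have h : orbitProj lam m = orbitSpaceIncl lam m ≫
      (affineHomEquiv _ _).symm fun t => coordFun (Sum.inr t) := by
    rw [comp_affineHomEquiv_symm, orbitProj]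
    congr 1
  have h1 : IsOpenImmersion (orbitSpaceIncl lam m).left :=
    inferInstanceAs (IsOpenImmersion (basicIncl _ _).left)
  have h2 := smooth_affineOver_inr (RepIndex lam m) (NFIndex lam)
  rw [h]
  exact smooth_comp (orbitSpaceIncl lam m).left _

theorem isReduced_orbitSpace : IsReduced (orbitSpace lam m).left := by
  have : IsReduced (affineOver (RepIndex lam m ⊕ NFIndex lam)).left :=
    inferInstanceAs (IsReduced 𝔸(RepIndex lam m ⊕ NFIndex lam; SpecC))
  have h1 : IsOpenImmersion (orbitSpaceIncl lam m).left :=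
    inferInstanceAs (IsOpenImmersion (basicIncl _ _).left)
  exact isReduced_of_isOpenImmersion (orbitSpaceIncl lam m).left

theorem exists_orbitSection (hlam : Antitone lam) (hm : colOrder lam n < m) :
    ∃ s : affineOver (NFIndex lam) ⟶ orbitSpace lam m,
      s ≫ orbitIncl lam m = normalFormHom lam m ∧ s ≫ orbitProj lam m = 𝟙 _ := by
  obtain ⟨s, h1, h2⟩ := exists_comp_orbitIncl (T := affineOver (NFIndex lam)) hlam hm
    (V := 1) (by simp) fun e => coordFun e
  refine ⟨s, by rw [h2, Matrix.one_mul]; rfl, ?_⟩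
  rw [comp_orbitProj_eq_iff, h1]
  rfl

theorem exists_orbitAction (hlam : Antitone lam) (hm : colOrder lam n < m) :
    ∃ a : jetGL n m ⊗ orbitSpace lam m ⟶ orbitSpace lam m,
      a ≫ orbitIncl lam m = jetMul (fst _ _) (snd _ _ ≫ orbitIncl lam m) ∧
      a ≫ orbitProj lam m = snd _ _ ≫ orbitProj lam m := by
  obtain ⟨G, hG, -⟩ := exists_jetHom_eq
    (fst (jetGL n m) (orbitSpace lam m) ≫ jetGLIncl n m)
  -- The product `G * H` may exceed the degree bounds; its canonical representative gives the same
  -- jet and the same normal form.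
  obtain ⟨a, h1, h2⟩ := exists_comp_orbitIncl hlam hm
    (V := G * repMatrix lam m (repCoord (snd (jetGL n m) (orbitSpace lam m)))) (by
      rw [Matrix.det_mul]
      exact (isUnit_det_of_jetGL hG).mul (isUnit_det_repCoord _))
    (nfCoord (snd (jetGL n m) (orbitSpace lam m)))
  refine ⟨a, ?_, ?_⟩
  · rw [h2, comp_orbitIncl, jetMul_jetHom hG, Matrix.mul_assoc]
  · rw [comp_orbitProj, comp_orbitProj, h1]

/-- The matrix whose entries in the `j`-th column have the given coefficients in degrees from
`m + 1 - pivot lam j` to `m`. -/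
noncomputable def highMatrix {R : Type} [CommRing R] (lam : Fin n → ℕ) (m : ℕ)
    (v : (Σ q : Fin n × Fin n, Fin (pivot lam q.2)) → R) : Matrix (Fin n) (Fin n) R⟦X⟧ :=
  Matrix.of fun i j =>
    (∑ k : Fin (pivot lam j), monomial (k : ℕ) (v ⟨(i, j), k⟩)) * X ^ (m + 1 - pivot lam j)

theorem jetMul_comp {T T' : Over SpecC} (f : T' ⟶ T) (g : T ⟶ jetGL n m) (x : T ⟶ jetMat n m) :
    f ≫ jetMul g x = jetMul (f ≫ g) (f ≫ x) := by
  obtain ⟨G, hG, -⟩ := exists_jetHom_eq (g ≫ jetGLIncl n m)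
  obtain ⟨A, rfl, -⟩ := exists_jetHom_eq x
  have h : jetHom m (G.map (PowerSeries.map (pullFun f))) = (f ≫ g) ≫ jetGLIncl n m := by
    rw [← comp_jetHom, hG, Category.assoc]
  rw [jetMul_jetHom hG, comp_jetHom, comp_jetHom, jetMul_jetHom h, Matrix.map_mul]

theorem jetHom_normalForm {T : Over SpecC} (c : T ⟶ affineOver (NFIndex lam)) :
    c ≫ normalFormHom lam m = jetHom m (normalForm lam (affineHomEquiv _ T c)) := by
  have : normalFormHom lam m = jetHom m (normalForm lam fun e => coordFun e) := rfl
  rw [this, comp_jetHom, map_normalForm]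
  rfl

section OrbitMap

variable {o : jetGL n m ⊗ affineOver (NFIndex lam) ⟶ orbitSpace lam m}

theorem lift_orbitMap
    (ho : o ≫ orbitIncl lam m = jetMul (fst _ _) (snd _ _ ≫ normalFormHom lam m)) {T : Over SpecC} {g : T ⟶ jetGL n m} (c : T ⟶ affineOver (NFIndex lam))
    {G : Matrix (Fin n) (Fin n) Γ(T.left, ⊤)⟦X⟧} (hG : jetHom m G = g ≫ jetGLIncl n m) :
    lift g c ≫ o ≫ orbitIncl lam m =
      jetHom m (G * normalForm lam (affineHomEquiv _ T c)) := by
  rw [ho, jetMul_comp, lift_fst, lift_snd_assoc, jetHom_normalForm, jetMul_jetHom hG]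

/-- Over a point `(H, c)`, the coefficients of `G` in column `j` of degree from `m + 1 - pivot lam
j` to `m` can be prescribed freely, and they determine `G`. -/
theorem smooth_orbitMap (hlam : Antitone lam) (hm : ∀ k, colOrder lam k < m)
    (ho : o ≫ orbitIncl lam m = jetMul (fst _ _) (snd _ _ ≫ normalFormHom lam m))
    (hp : o ≫ orbitProj lam m = snd _ _) : Smooth o.left := by
  let hi : (Σ q : Fin n × Fin n, Fin (pivot lam q.2)) → Fin n × Fin n × Fin (m + 1) := fun q =>
    (q.1.1, q.1.2, ⟨m + 1 - pivot lam q.1.2 + q.2, by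
      have := pivot_le hlam hm q.1.2
      omega⟩)
  let k : jetGL n m ⊗ affineOver (NFIndex lam) ⟶
      affineOver (Σ q : Fin n × Fin n, Fin (pivot lam q.2)) :=
    (affineHomEquiv _ _).symm
      (affineHomEquiv _ _ (fst (jetGL n m) (affineOver (NFIndex lam)) ≫ jetGLIncl n m) ∘ hi)
  have hk : ∀ {T : Over SpecC} {g : T ⟶ jetGL n m} (c : T ⟶ affineOver (NFIndex lam))
      {G : Matrix (Fin n) (Fin n) Γ(T.left, ⊤)⟦X⟧}, jetHom m G = g ≫ jetGLIncl n m →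
      ∀ q, affineHomEquiv _ T (lift g c ≫ k) q =
        coeff (m + 1 - pivot lam q.1.2 + q.2 : ℕ) (G q.1.1 q.1.2) := by
    intro T g c G hG q
    rw [comp_affineHomEquiv_symm, Equiv.apply_symm_apply, ← Function.comp_assoc]
    have h1 : pullFun (lift g c) ∘ affineHomEquiv (Fin n × Fin n × Fin (m + 1)) _
        (fst (jetGL n m) (affineOver (NFIndex lam)) ≫ jetGLIncl n m) =
        affineHomEquiv (Fin n × Fin n × Fin (m + 1)) _ (jetHom m G) := by
      have h2 : lift g c ≫ fst (jetGL n m) (affineOver (NFIndex lam)) ≫ jetGLIncl n m =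
          g ≫ jetGLIncl n m := by rw [← Category.assoc, lift_fst]
      rw [hG]
      exact (affineHomEquiv_comp (σ := Fin n × Fin n × Fin (m + 1)) _ _).symm.trans
        (congrArg (affineHomEquiv (Fin n × Fin n × Fin (m + 1)) T) h2)
    refine (congrFun h1 (hi q)).trans ?_
    rw [affineHomEquiv_jetHom]
  have := mono_orbitIncl hlam hm
  refine smooth_of_bijective o k fun T y v => ?_
  let κ := affineHomEquiv _ T v
  refine existsUnique_of_exists_of_unique ?_ ?_
  -- The prescribed high part is removed before reduction and added back afterwards. Constant terms
  -- agree with those of `H`, so `G` stays invertible.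
  · obtain ⟨w, h1, h2⟩ := exists_repMatrix hlam (hm n) (nfCoord y)
      (repMatrix lam m (repCoord y) - highMatrix lam m κ)
    let G := highMatrix lam m κ + repMatrix lam m w
    have hGa : ∀ i j, G i j = highMatrix lam m κ i j + repMatrix lam m w i j := fun _ _ => rfl
    have hGu : IsUnit G.det := by
      refine (isUnit_det_iff_of_constantCoeff_eq fun i j => ?_).2 (isUnit_det_repCoord y)
      rw [hGa, map_add, h2, Matrix.sub_apply, map_sub, add_sub_cancel]
    obtain ⟨g, hg⟩ := exists_jetGL (m := m) hGu
    let c := (affineHomEquiv _ T).symm (nfCoord y)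
    have hc : affineHomEquiv _ T c = nfCoord y := Equiv.apply_symm_apply _ _
    refine ⟨lift g c, ?_, ?_⟩
    · rw [← cancel_mono (orbitIncl lam m), Category.assoc, lift_orbitMap ho c hg.symm, hc,
        comp_orbitIncl, jetHom_eq_iff, Matrix.add_mul, psi_add, ← h1, ← psi_add,
        ← Matrix.add_mul, add_sub_cancel]
    · refine (affineHomEquiv _ T).injective (funext fun q => ?_)
      rw [hk c hg.symm, hGa, map_add, coeff_repMatrix_of_le _ _ _ _ le_self_add,
        add_zero, highMatrix, Matrix.of_apply, add_comm, coeff_mul_X_pow, coeff_sum_monomial,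
        dif_pos q.2.2]
  · rintro x x' ⟨hx1, hx2⟩ ⟨hx1', hx2'⟩
    obtain ⟨g, c, rfl⟩ : ∃ g c, x = lift g c := ⟨x ≫ fst _ _, x ≫ snd _ _, by simp⟩
    obtain ⟨g', c', rfl⟩ : ∃ g c, x' = lift g c := ⟨x' ≫ fst _ _, x' ≫ snd _ _, by simp⟩
    have hc : c = c' := by
      have h1 := congrArg (· ≫ orbitProj lam m) (hx1.trans hx1'.symm)
      simpa [hp] using h1
    subst hc
    obtain ⟨G, hG, hGd⟩ := exists_jetHom_eq (g ≫ jetGLIncl n m)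
    obtain ⟨G', hG', hGd'⟩ := exists_jetHom_eq (g' ≫ jetGLIncl n m)
    have h1 := congrArg (· ≫ orbitIncl lam m) (hx1.trans hx1'.symm)
    simp only [Category.assoc] at h1
    rw [lift_orbitMap ho c hG, lift_orbitMap ho c hG', jetHom_eq_iff, psi_eq_psi_iff] at h1
    -- Equal high coefficients put the difference within the degree bounds where multiplication by
    -- `L(c)` is injective modulo `X ^ (m + 1)`.
    have h2 : G - G' = 0 := by
      refine eq_zero_of_dvd_mul (fun i j => normalForm_of_gt lam _) (normalForm_diag lam _)
        (L := normalForm lam (affineHomEquiv (NFIndex lam) T c)) (N := m + 1)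
        (fun i j l hl => ?_) (by rw [Matrix.sub_mul]; exact h1)
      rw [Matrix.sub_apply, map_sub, sub_eq_zero]
      by_cases hl' : m + 1 ≤ l
      · rw [hGd _ _ _ hl', hGd' _ _ _ hl']
      · obtain ⟨e, rfl⟩ := Nat.exists_eq_add_of_le hl
        have he : e < pivot lam j := by omega
        have h3 := hk c hG ⟨(i, j), ⟨e, he⟩⟩
        rw [hx2, ← hx2', hk c hG' ⟨(i, j), ⟨e, he⟩⟩] at h3
        exact h3.symm
    have hg : g = g' := by
      rw [← cancel_mono (jetGLIncl n m), ← hG, ← hG', sub_eq_zero.1 h2]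
    rw [hg]

theorem surjective_orbitMap (hlam : Antitone lam) (hm : ∀ k, colOrder lam k < m)
    (ho : o ≫ orbitIncl lam m = jetMul (fst _ _) (snd _ _ ≫ normalFormHom lam m)) : Surjective o.left := by
  have := mono_orbitIncl hlam hm
  obtain ⟨g, hg⟩ := exists_jetGL (m := m) (isUnit_det_repCoord (𝟙 (orbitSpace lam m)))
  -- The pair `(H, c)` is itself a point of the source, which gives a section.
  refine surjective_of_section o (lift g (orbitProj lam m)) ?_
  rw [← cancel_mono (orbitIncl lam m), Category.assoc, lift_orbitMap ho _ hg.symm,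
    comp_orbitIncl, orbitProj, Equiv.apply_symm_apply]

end OrbitMap

end Maps

/-! ### Complex points and uniqueness of the normal form -/

section ComplexPoints

variable {n : ℕ} {lam : Fin n → ℕ} {m : ℕ}

/-- The identification of `ℂ` with the global functions on `Spec ℂ`. -/
noncomputable def constFun : ℂ ≃+* Γ(pt.left, ⊤) :=
  (Scheme.ΓSpecIso (CommRingCat.of ℂ)).symm.commRingCatIsoToRingEquiv

theorem affinePoint_eq {σ : Type} (c : σ → ℂ) :
    affinePoint c = (affineHomEquiv σ pt).symm (constFun ∘ c) := rfl

theorem affinePoint_injective {σ : Type} : Function.Injective (affinePoint (σ := σ)) := by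
  intro c c' h
  rw [affinePoint_eq, affinePoint_eq, Equiv.apply_eq_iff_eq] at h
  exact constFun.injective.comp_left h

theorem jetPoint_psi (A : Arc n) :
    jetPoint (psi m A) = jetHom m (A.map (PowerSeries.map (constFun : ℂ →+* _))) := by
  refine (jetHom_eq_of_affineHomEquiv fun i j k => ?_).symm
  have h : affineHomEquiv (Fin n × Fin n × Fin (m + 1)) pt (jetPoint (psi m A)) =
      constFun ∘ fun q => jetCoeff q.2.2 (psi m A q.1 q.2.1) := Equiv.apply_symm_apply _ _
  refine (congrFun h (i, j, k)).trans ?_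
  rw [Matrix.map_apply, coeff_map]
  rfl

theorem jetPoint_injective : Function.Injective (jetPoint (n := n) (m := m)) := by
  intro x x' h
  have h1 := affinePoint_injective h
  ext i j
  rw [← jetOfCoeffs_jetCoeff (x i j), ← jetOfCoeffs_jetCoeff (x' i j)]
  congr 1
  funext k
  exact congrFun h1 (i, j, k)

theorem exists_point_jetPoint (hlam : Antitone lam) (hm : colOrder lam n < m) {g : Arc n}
    (hg : IsUnit g.det) (c : NFIndex lam → ℂ) :
    ∃ y : pt ⟶ orbitSpace lam m, y ≫ orbitProj lam m = affinePoint c ∧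
      y ≫ orbitIncl lam m = jetPoint (psi m (g * normalForm lam c)) := by
  obtain ⟨y, h1, h2⟩ := exists_comp_orbitIncl hlam hm
    (V := g.map (PowerSeries.map (constFun : ℂ →+* Γ(pt.left, ⊤)))) (by
      rw [← RingHom.mapMatrix_apply, ← RingHom.map_det]
      exact hg.map _) (constFun ∘ c)
  refine ⟨y, by rw [comp_orbitProj, h1, affinePoint_eq], ?_⟩
  rw [h2, jetPoint_psi, map_mul_normalForm]
  rfl

theorem exists_eq_of_point (y : pt ⟶ orbitSpace lam m) :
    ∃ (g : Arc n) (c : NFIndex lam → ℂ), IsUnit g.det ∧ y ≫ orbitProj lam m = affinePoint c ∧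
      y ≫ orbitIncl lam m = jetPoint (psi m (g * normalForm lam c)) := by
  let v : RepIndex lam m → ℂ := constFun.symm ∘ repCoord y
  let c : NFIndex lam → ℂ := constFun.symm ∘ nfCoord y
  have hv : (constFun : ℂ →+* Γ(pt.left, ⊤)) ∘ v = repCoord y :=
    funext fun _ => constFun.apply_symm_apply _
  have hc : (constFun : ℂ →+* Γ(pt.left, ⊤)) ∘ c = nfCoord y :=
    funext fun _ => constFun.apply_symm_apply _
  have hy := isUnit_det_repCoord y
  refine ⟨repMatrix lam m v, c, ?_, ?_, ?_⟩
  · rw [← hv, ← map_repMatrix, ← RingHom.mapMatrix_apply, ← RingHom.map_det,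
      isUnit_iff_constantCoeff, ← coeff_zero_eq_constantCoeff_apply, coeff_map,
      coeff_zero_eq_constantCoeff_apply] at hy
    rw [isUnit_iff_constantCoeff]
    exact (MulEquiv.isUnit_map constFun).1 hy
  · rw [comp_orbitProj, affinePoint_eq, ← hc]
    rfl
  · rw [comp_orbitIncl, jetPoint_psi, map_mul_normalForm, map_repMatrix, hv, hc]

theorem exists_mul_eq_iff (g : Arc n) (c c' : NFIndex lam → ℂ) :
    (∃ u : Matrix.GeneralLinearGroup (Fin n) (TruncRing ℂ m),
      (u : Jet n m) * psi m (g * normalForm lam c) = psi m (normalForm lam c')) ↔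
    ∃ h : Arc n, IsUnit h.det ∧
      psi m (g * normalForm lam c) = psi m (h * normalForm lam c') := by
  constructor
  · rintro ⟨u, hu⟩
    obtain ⟨B, hB⟩ := psi_surjective ((u⁻¹ : Matrix.GeneralLinearGroup _ _) : Jet n m)
    refine ⟨B, isUnit_det_of_isUnit_psi (m := m) (hB ▸ Units.isUnit _), ?_⟩
    rw [psi_mul B, hB, ← hu, ← Matrix.mul_assoc, ← Units.val_mul, inv_mul_cancel, Units.val_one,
      Matrix.one_mul]
  · rintro ⟨h, hh, heq⟩
    obtain ⟨u, hu⟩ := isUnit_psi (m := m) hh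
    refine ⟨u⁻¹, ?_⟩
    rw [heq, psi_mul, ← hu, ← Matrix.mul_assoc, ← Units.val_mul, inv_mul_cancel, Units.val_one,
      Matrix.one_mul]

theorem comp_orbitProj_eq_affinePoint_iff (hlam : Antitone lam) (hm : ∀ k, colOrder lam k < m)
    {x : Jet n m} {y : pt ⟶ orbitSpace lam m} (hy : y ≫ orbitIncl lam m = jetPoint x)
    (c : NFIndex lam → ℂ) :
    y ≫ orbitProj lam m = affinePoint c ↔
      ∃ g : Matrix.GeneralLinearGroup (Fin n) (TruncRing ℂ m),
        (g : Jet n m) * x = psi m (normalForm lam c) := by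
  obtain ⟨g, c', hg, hyc, hyg⟩ := exists_eq_of_point y
  obtain rfl := jetPoint_injective (hy.symm.trans hyg)
  rw [exists_mul_eq_iff, hyc, affinePoint_injective.eq_iff]
  refine ⟨fun h => ⟨g, hg, by rw [h]⟩, fun ⟨h, hh, heq⟩ => ?_⟩
  obtain ⟨y', h1, h2⟩ := exists_point_jetPoint hlam (hm n) hh c
  have := mono_orbitIncl hlam hm
  -- Two factorizations of one jet give the same point of `S`, hence the same normal form.
  have hyy : y = y' := by rw [← cancel_mono (orbitIncl lam m), hyg, h2, heq]
  rw [← affinePoint_injective.eq_iff, ← hyc, hyy, h1]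

theorem isReducedLocus_orbitIncl (hlam : Antitone lam) (hm : ∀ k, colOrder lam k < m) :
    IsReducedLocus (contactJets lam m) (orbitIncl lam m) where
  isReduced := isReduced_orbitSpace
  isImmersion := isImmersion_orbitIncl hlam hm
  mem_iff x := by
    rw [mem_contactJets_iff hlam]
    constructor
    · rintro ⟨g, c, hg, rfl⟩
      obtain ⟨y, -, hy⟩ := exists_point_jetPoint hlam (hm n) hg c
      exact ⟨y, hy⟩
    · rintro ⟨y, hy⟩
      obtain ⟨g, c, hg, -, hyg⟩ := exists_eq_of_point y
      exact ⟨g, c, hg, jetPoint_injective (hy.symm.trans hyg)⟩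

theorem existsUnique_normalForm (hlam : Antitone lam) (hm : ∀ k, colOrder lam k < m)
    {x : Jet n m} (hx : x ∈ contactJets lam m) :
    ∃! c : NFIndex lam → ℂ, ∃ g : Matrix.GeneralLinearGroup (Fin n) (TruncRing ℂ m),
      (g : Jet n m) * x = psi m (normalForm lam c) := by
  obtain ⟨y, hy⟩ := ((isReducedLocus_orbitIncl hlam hm).mem_iff x).1 hx
  obtain ⟨_, c, -, hyc, -⟩ := exists_eq_of_point y
  simp only [← comp_orbitProj_eq_affinePoint_iff hlam hm hy]
  exact ⟨c, hyc, fun c' hc' => affinePoint_injective (hc'.symm.trans hyc)⟩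

theorem isAffineFamilyOfOrbits (hlam : Antitone lam) (hm : ∀ k, colOrder lam k < m)
    {a : jetGL n m ⊗ orbitSpace lam m ⟶ orbitSpace lam m}
    (ha : a ≫ orbitIncl lam m = jetMul (fst _ _) (snd _ _ ≫ orbitIncl lam m))
    (hap : a ≫ orbitProj lam m = snd _ _ ≫ orbitProj lam m)
    {s : affineOver (NFIndex lam) ⟶ orbitSpace lam m}
    (hs : s ≫ orbitIncl lam m = normalFormHom lam m) (hsp : s ≫ orbitProj lam m = 𝟙 _) :
    IsAffineFamilyOfOrbits a (orbitProj lam m) s := by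
  have h1 : (jetGL n m ◁ s ≫ a) ≫ orbitIncl lam m =
      jetMul (fst _ _) (snd _ _ ≫ normalFormHom lam m) := by
    rw [Category.assoc, ha, jetMul_comp, whiskerLeft_fst, ← Category.assoc, whiskerLeft_snd,
      Category.assoc, hs]
  have h2 : (jetGL n m ◁ s ≫ a) ≫ orbitProj lam m = snd _ _ := by
    rw [Category.assoc, hap, ← Category.assoc, whiskerLeft_snd, Category.assoc, hsp,
      Category.comp_id]
  exact ⟨smooth_orbitProj, hap, hsp, smooth_orbitMap hlam hm h1 h2,
    surjective_orbitMap hlam hm h1⟩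

end ComplexPoints

end GLContact

theorem lemma9p3 (n : ℕ) (hn : 0 < n) (lam : Fin n → ℕ) (hlam : Antitone lam)
    (m : ℕ) (hm : lam ⟨0, hn⟩ < m) :
    -- the contact locus is the preimage of its image `C_m` in the space of `m`-jets
    GLContact.contactLocus lam = GLContact.psi m ⁻¹' GLContact.contactJets lam m ∧
    -- `C_m` does not meet the jet scheme of `V_1`
    (∀ x ∈ GLContact.contactJets lam m,
      (fun q : Fin n × Fin n => x q.1 q.2) ∉
        GLContact.jetsOf (GLContact.detIdeal n ⟨0, hn⟩) m) ∧
    -- the normal forms lie in the contact locus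
    (∀ c : GLContact.NFIndex lam → ℂ,
      GLContact.normalForm lam c ∈ GLContact.contactLocus lam) ∧
    -- `C_m` is a union of orbits, and each of them has a unique normal form
    (∀ x ∈ GLContact.contactJets lam m,
      ∀ g : Matrix.GeneralLinearGroup (Fin n) (GLContact.TruncRing ℂ m),
        (g : GLContact.Jet n m) * x ∈ GLContact.contactJets lam m) ∧
    (∀ x ∈ GLContact.contactJets lam m, ∃! c : GLContact.NFIndex lam → ℂ,
      ∃ g : Matrix.GeneralLinearGroup (Fin n) (GLContact.TruncRing ℂ m),
        (g : GLContact.Jet n m) * x = GLContact.psi m (GLContact.normalForm lam c)) ∧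
    -- `C_m` is a variety, and it is an affine family of orbits through the normal form map
    ∃ (S : Over GLContact.SpecC) (ι : S ⟶ GLContact.jetMat n m)
      (a : GLContact.jetGL n m ⊗ S ⟶ S)
      (p : S ⟶ GLContact.affineOver (GLContact.NFIndex lam))
      (s : GLContact.affineOver (GLContact.NFIndex lam) ⟶ S),
      GLContact.IsReducedLocus (GLContact.contactJets lam m) ι ∧
      a ≫ ι = GLContact.jetMul (fst _ _) (snd _ _ ≫ ι) ∧
      s ≫ ι = GLContact.normalFormHom lam m ∧
      GLContact.IsAffineFamilyOfOrbits a p s ∧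
      ∀ (x : GLContact.Jet n m) (y : GLContact.pt ⟶ S) (c : GLContact.NFIndex lam → ℂ),
        y ≫ ι = GLContact.jetPoint x →
          (y ≫ p = GLContact.affinePoint c ↔
            ∃ g : Matrix.GeneralLinearGroup (Fin n) (GLContact.TruncRing ℂ m),
              (g : GLContact.Jet n m) * x =
                GLContact.psi m (GLContact.normalForm lam c)) := by
  have hlt : ∀ i, lam i < m := fun i => (hlam (Fin.mk_le_of_le_val (Nat.zero_le _))).trans_lt hm
  have hcol := GLContact.colOrder_lt hlt (Nat.zero_lt_of_lt hm)
  obtain ⟨a, ha, hap⟩ := GLContact.exists_orbitAction hlam (hcol n)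
  obtain ⟨s, hs, hsp⟩ := GLContact.exists_orbitSection hlam (hcol n)
  exact ⟨GLContact.contactLocus_eq_preimage hlt,
    fun x hx => GLContact.notMem_jetsOf_detIdeal hlt hx _,
    GLContact.normalForm_mem_contactLocus hlam,
    fun x hx => GLContact.mul_mem_contactJets hx,
    fun x hx => GLContact.existsUnique_normalForm hlam hcol hx,
    GLContact.orbitSpace lam m, GLContact.orbitIncl lam m, a, GLContact.orbitProj lam m, s,
    GLContact.isReducedLocus_orbitIncl hlam hcol, ha, hs,
    GLContact.isAffineFamilyOfOrbits hlam hcol ha hap hs hsp,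
    fun x y c hy => GLContact.comp_orbitProj_eq_affinePoint_iff hlam hcol hy c⟩
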